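/- Let $d\ge 2$, let $\mathbb F$ be a field, and let $f$ be a Lebesgue-almost everywhere continuous probability density on $\mathbb R^d$ whose support is compact, convex and contains the origin, and which satisfies $0<\inf_{x\in\operatorname{supp} f}f(x)\le\sup_{x\in\mathbb R^d}f(x)<\infty$. For a set $X\subset\mathbb R^d$ and $s>0$, let $\check C(X,s)$ be the \v{C}ech complex of radius $s$: its simplices are the nonempty finite sets $\sigma\subseteq X$ such that the closed balls $B_x(s)$, $x\in\sigma$, have a common point. Let $\beta_k(\check C(X,s))$ be the dimension over $\mathbb F$ of its $k$-th simplicial homology with coefficients in $\mathbb F$. Let $1\le k\le d-1$ and let $r_n>0$ be radii with $nr_n^d\to r\in(0,\infty)$ as $n\to\infty$. On a common probability space, for each $n$ let $\mathcal P_n$ be a Poisson point process on $\mathbb R^d$ with intensity $nf$, and let $\mathcal X_n=\{X_{n,1},\dots,X_{n,n}\}$ be a binomial point process, where $X_{n,1},\dots,X_{n,n}$ are i.i.d. random vectors with density $f$ (for example $X_{n,i}=X_i$ for a single i.i.d. sequence $X_1,X_2,\dots$). No assumption is made on the joint distribution of the processes for different $n$. Then $\beta_k(\check C(\mathcal P_n,r_n))$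 and $\beta_k(\check C(\mathcal X_n,r_n))$ are integrable for every $n$, and, with probability one, $$\lim_{n\to\infty}n^{-1}\bigl[\beta_k(\check C(\mathcal P_n,r_n))-\mathbb E\,\beta_k(\check C(\mathcal P_n,r_n))\bigr]=0$$ and $$\lim_{n\to\infty}n^{-1}\bigl[\beta_k(\check C(\mathcal X_n,r_n))-\mathbb E\,\beta_k(\check C(\mathcal X_n,r_n))\bigr]=0 .$$ -/

import Mathlib

open MeasureTheory ProbabilityTheory Filter Topology

noncomputable section

namespace CechBetti

/-! ### Simplicial homology of an abstract simplicial complex, over a field -/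

/-- The dimension of the quotient space `Z / B` of two subspaces `B ≤ Z` of a vector space. -/
def quotientDim {F M : Type*} [Field F] [AddCommGroup M] [Module F M] (Z B : Submodule F M) : ℕ :=
  Module.finrank F (Z ⧸ B.submoduleOf Z)

section Homology

variable {V : Type*} [LinearOrder V]

/-- The simplicial boundary operator on formal `F`-linear combinations of finite sets. A finite set
`σ = {v₀ < v₁ < ⋯ < vₘ}` is oriented by the order of its vertices, and
`∂ σ = ∑ i, (-1)^i • (σ \ {vᵢ})`; the index `i` of a vertex `v` is the number of vertices of `σ`
that are smaller than `v`. -/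
def boundary (F : Type*) [Field F] : (Finset V →₀ F) →ₗ[F] (Finset V →₀ F) :=
  Finsupp.linearCombination F fun σ : Finset V =>
    ∑ v ∈ σ, Finsupp.single (σ.erase v) ((-1 : F) ^ (σ.filter (· < v)).card)

/-- The space `C_k(K)` of simplicial `k`-chains: the formal linear combinations of the `k`-simplices
of `K`, that is, of its faces with `k + 1` vertices. -/
def chains (F : Type*) [Field F] (K : PreAbstractSimplicialComplex V) (k : ℕ) :
    Submodule F (Finset V →₀ F) :=
  Finsupp.supported F F {σ : Finset V | σ ∈ K.faces ∧ σ.card = k + 1}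

/-- The space `Z_k(K)` of `k`-cycles. Homology is not reduced: every `0`-chain is a cycle. -/
def cycles (F : Type*) [Field F] (K : PreAbstractSimplicialComplex V) :
    ℕ → Submodule F (Finset V →₀ F)
  | 0 => chains F K 0
  | k + 1 => chains F K (k + 1) ⊓ LinearMap.ker (boundary F)

/-- The space `B_k(K)` of `k`-boundaries: the image of `C_{k+1}(K)` under `∂`. -/
def boundaries (F : Type*) [Field F] (K : PreAbstractSimplicialComplex V) (k : ℕ) :
    Submodule F (Finset V →₀ F) :=
  (chains F K (k + 1)).map (boundary F)

/-- The `k`-th Betti number `β_k(K) = dim_F Z_k(K) / B_k(K)`. -/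
def bettiNumber (F : Type*) [Field F] (K : PreAbstractSimplicialComplex V) (k : ℕ) : ℕ :=
  quotientDim (cycles F K k) (boundaries F K k)

theorem boundary_single (F : Type*) [Field F] (σ : Finset V) (a : F) :
    boundary F (Finsupp.single σ a) =
      ∑ v ∈ σ, Finsupp.single (σ.erase v) (a * (-1 : F) ^ (σ.filter (· < v)).card) := by
  simp [boundary, Finset.smul_sum]

theorem boundary_boundary (F : Type*) [Field F] (c : Finset V →₀ F) :
    boundary F (boundary F c) = 0 := by
  induction c using Finsupp.induction_linear with
  | zero => simp
  | add x y hx hy => rw [map_add, map_add, hx, hy, add_zero]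
  | single σ a =>
    rw [boundary_single, map_sum]
    simp only [boundary_single]
    rw [Finset.sum_sigma']
    refine Finset.sum_involution (fun p _ => ⟨p.2, p.1⟩) ?_ ?_ ?_ ?_
    · rintro ⟨v, w⟩ h
      simp only [Finset.mem_sigma, Finset.mem_erase] at h
      obtain ⟨hv, hwv, hw⟩ := h
      dsimp only
      rw [Finset.erase_right_comm, ← Finsupp.single_add, Finsupp.single_eq_zero]
      have key : ∀ x y : V, x ∈ σ → y ∈ σ → x < y →
          ((σ.erase x).filter (· < y)).card + 1 = (σ.filter (· < y)).card ∧
          ((σ.erase y).filter (· < x)).card = (σ.filter (· < x)).card := by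
        intro x y hx hy hxy
        constructor
        · rw [Finset.filter_erase, Finset.card_erase_add_one]
          simp [hx, hxy]
        · rw [Finset.filter_erase, Finset.erase_eq_of_notMem]
          simp [hxy.le]
      rcases lt_or_gt_of_ne hwv with h | h
      · obtain ⟨h1, h2⟩ := key w v hw hv h
        rw [h2, ← h1]
        ring
      · obtain ⟨h1, h2⟩ := key v w hv hw h
        rw [h2, ← h1]
        ring
    · rintro ⟨v, w⟩ h _ he
      simp only [Finset.mem_sigma, Finset.mem_erase] at h
      simp only [Sigma.mk.injEq] at he
      exact h.2.1 he.1
    · rintro ⟨v, w⟩ h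
      simp only [Finset.mem_sigma, Finset.mem_erase] at h ⊢
      exact ⟨h.2.2, Ne.symm h.2.1, h.1⟩
    · rintro ⟨v, w⟩ h
      rfl

theorem boundaries_le_cycles (F : Type*) [Field F] (K : PreAbstractSimplicialComplex V) (k : ℕ) :
    boundaries F K k ≤ cycles F K k := by
  have hC : boundaries F K k ≤ chains F K k := by
    rw [boundaries, chains, Finsupp.supported_eq_span_single, Submodule.map_span,
      Submodule.span_le]
    rintro _ ⟨_, ⟨σ, ⟨hσ, hcard⟩, rfl⟩, rfl⟩
    rw [boundary_single]
    refine Submodule.sum_mem _ fun v hv => Finsupp.single_mem_supported F _ ?_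
    have hc : (σ.erase v).card = k + 1 := by rw [Finset.card_erase_of_mem hv, hcard]; rfl
    exact ⟨(K.isRelLowerSet_faces hσ).2 (Finset.erase_subset v σ)
      (Finset.card_pos.1 (by omega)), hc⟩
  cases k with
  | zero => exact hC
  | succ k =>
    refine le_inf hC ?_
    rintro _ ⟨c, -, rfl⟩
    exact boundary_boundary F c

end Homology

/-! ### The Čech complex -/

/-- The Čech complex of radius `r` of a set `X` of points: its simplices are the nonempty finite
subsets `σ` of `X` for which the (closed) balls of radius `r` around the points of `σ` have a common
point. -/
def cechComplex {E : Type*} [PseudoMetricSpace E] (X : Set E) (r : ℝ) :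
    PreAbstractSimplicialComplex E where
  faces := {σ : Finset E | σ.Nonempty ∧ (σ : Set E) ⊆ X ∧
    (⋂ x ∈ σ, Metric.closedBall x r).Nonempty}
  isRelLowerSet_faces := by
    rintro σ ⟨hne, hsub, y, hy⟩
    refine ⟨hne, fun τ hτ hτne => ⟨hτne, fun x hx => hsub (hτ hx), y, ?_⟩⟩
    simp only [Set.mem_iInter] at hy ⊢
    exact fun x hx => hy x (hτ hx)

/-- The lexicographic order on `ℝ^d`, used only to orient simplices (Betti numbers do not depend
on the choice of the order). -/
abbrev lexOrder (d : ℕ) : LinearOrder (EuclideanSpace ℝ (Fin d)) :=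
  LinearOrder.lift' (fun x : EuclideanSpace ℝ (Fin d) => toLex (fun i : Fin d => x i))
    (fun x y h => by
      ext i
      exact congrFun (toLex.injective h) i)

/-- The Betti number `β_k(Č(X, r))`, with coefficients in the field `F`, of the Čech complex of a
set `X` of points of `ℝ^d`. -/
def cechBetti (F : Type*) [Field F] {d : ℕ} (k : ℕ) (X : Set (EuclideanSpace ℝ (Fin d)))
    (r : ℝ) : ℕ :=
  letI := lexOrder d
  bettiNumber F (cechComplex X r) k

/-! ### Densities and point processes -/

/-- A Lebesgue-almost everywhere continuous probability density on `ℝ^d`, bounded above, whose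
support is compact, convex and contains the origin, and which is bounded away from zero on its
support. -/
structure IsAdmissibleDensity {d : ℕ} (f : EuclideanSpace ℝ (Fin d) → ℝ) : Prop where
  measurable : Measurable f
  nonneg : ∀ x, 0 ≤ f x
  integral_eq_one : ∫ x, f x = 1
  ae_continuousAt : ∀ᵐ x, ContinuousAt f x
  isCompact_support : IsCompact (tsupport f)
  convex_support : Convex ℝ (tsupport f)
  zero_mem_support : (0 : EuclideanSpace ℝ (Fin d)) ∈ tsupport f
  bounded_below : ∃ c : ℝ, 0 < c ∧ ∀ x ∈ tsupport f, c ≤ f x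
  bounded_above : ∃ C : ℝ, ∀ x, f x ≤ C

/-- A simple point process on a metric space, identified with its random set of points: the set is
locally finite and the numbers of points in bounded Borel sets are random variables. -/
structure IsPointProcess {Ω E : Type*} [MeasurableSpace Ω] [PseudoMetricSpace E]
    [MeasurableSpace E] (Φ : Ω → Set E) : Prop where
  finite_inter : ∀ ω, ∀ B : Set E, Bornology.IsBounded B → (Φ ω ∩ B).Finite
  measurable_count : ∀ B : Set E, Bornology.IsBounded B → MeasurableSet B →
    Measurable fun ω => (Φ ω ∩ B).ncard

/-- A (simple) Poisson point process with locally finite intensity measure `μ`: the number of points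
in a bounded Borel set `B` is Poisson with parameter `μ B`, and the numbers of points in pairwise
disjoint bounded Borel sets are independent. -/
structure IsPoissonProcess {Ω E : Type*} [MeasurableSpace Ω] [PseudoMetricSpace E]
    [MeasurableSpace E] (Φ : Ω → Set E) (μ : Measure E) (P : Measure Ω) : Prop
    extends IsPointProcess Φ where
  intensity_lt_top : ∀ B : Set E, Bornology.IsBounded B → μ B < ⊤
  hasLaw_count : ∀ B : Set E, Bornology.IsBounded B → MeasurableSet B →
    HasLaw (fun ω => (Φ ω ∩ B).ncard) (poissonMeasure (μ B).toNNReal) P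
  iIndepFun_count : ∀ (m : ℕ) (B : Fin m → Set E), (∀ i, Bornology.IsBounded (B i)) →
    (∀ i, MeasurableSet (B i)) → Pairwise (fun i j => Disjoint (B i) (B j)) →
    iIndepFun (fun i ω => (Φ ω ∩ B i).ncard) P

/-- `X₁, …, Xₙ` are independent random vectors, each with law `ν`. -/
structure IsIIDSample {Ω E : Type*} [MeasurableSpace Ω] [MeasurableSpace E] {n : ℕ}
    (X : Fin n → Ω → E) (ν : Measure E) (P : Measure Ω) : Prop where
  measurable : ∀ i, Measurable (X i)
  hasLaw : ∀ i, HasLaw (X i) ν P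
  iIndepFun : iIndepFun X P

/-- The point process `{X₁, …, Xₙ}` of a sample (a binomial process, if the sample is i.i.d.). -/
def samplePoints {Ω E : Type*} {n : ℕ} (X : Fin n → Ω → E) (ω : Ω) : Set E :=
  Set.range fun i => X i ω

end CechBetti

end

noncomputable section

set_option linter.unusedSectionVars false

namespace CechBetti

/-! ### Dimension counts for chains, cycles and boundaries of finite complexes. -/

section FiniteComplex

variable {V : Type*} [LinearOrder V] (F : Type*) [Field F]

/-! The heart of the matter is a fourth moment bound: the centred Betti number has fourth moment of
order `n ^ 2`. Divided by `n`, its fourth moments are of order `n ^ (-2)`, which is summable, so the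
normalised fluctuations tend to zero almost surely however the processes for different `n` are
coupled (`ae_tendsto_zero_of_fourth_moment`). A variance bound of order `n` would not be summable
after this normalisation.

The bound rests on locality. Adding simplices changes a Betti number by at most their number
(`abs_bettiNumber_sub_le`), and a new point only creates simplices made of itself and points at
distance at most `2 * r n`. The effect of one point is thus at most 2 to the power of its degree
(`abs_bettiNumber_insert_sub_le`). As the density is bounded and `n * r n ^ d` is bounded, the
exponential moments of the degree are bounded (`integral_pow_degree_le`). For a function of `m`
independent variables, such control of every single-variable change yields a fourth centred moment
of order `m ^ 2`, by integrating out one variable at a time (`fourth_moment_pi_le`). This settles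
the binomial case.

A Poisson process, restricted to the support of the density, has the law of a sample of Poisson
size, because both have the same void probabilities (`IsPoissonProcess.map_restrict`). Given the
size `m`, the deviation splits into the fluctuation of an `m`-sample and the difference between the
means for sizes `m` and `n`. The latter is at most `|m - n|` up to exponential weights, and a
Poisson variable of mean `n` has fourth centred moment of order `n ^ 2`, even with these weights
(`lintegral_poissonSample_le`).

Measurability comes from discretisation: rounding the points and enlarging the radius slightly does
not alter the Betti number (`eventually_bettiNumber_image_eq`). -/

theorem finrank_supported {s : Set (Finset V)} (hs : s.Finite) :
    Module.finrank F (Finsupp.supported F F s) = s.ncard := by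
  have := hs.fintype
  rw [(Finsupp.supportedEquivFinsupp (M := F) (R := F) s).finrank_eq,
    Module.finrank_finsupp_self, Set.ncard_eq_toFinset_card', Set.toFinset_card]

theorem finrank_chains {K : PreAbstractSimplicialComplex V} (hK : K.faces.Finite) (k : ℕ) :
    Module.finrank F (chains F K k) = {σ : Finset V | σ ∈ K.faces ∧ σ.card = k + 1}.ncard :=
  finrank_supported F (hK.subset fun _ hσ => hσ.1)

theorem finite_chains {K : PreAbstractSimplicialComplex V} (hK : K.faces.Finite) (k : ℕ) :
    FiniteDimensional F (chains F K k) := by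
  have : Finite {σ : Finset V | σ ∈ K.faces ∧ σ.card = k + 1} :=
    (hK.subset fun σ hσ => hσ.1).to_subtype
  exact Module.Finite.equiv (Finsupp.supportedEquivFinsupp (M := F) (R := F) _).symm

theorem cycles_le_chains (K : PreAbstractSimplicialComplex V) (k : ℕ) :
    cycles F K k ≤ chains F K k := by
  cases k with
  | zero => exact le_rfl
  | succ k => exact inf_le_left

theorem chains_mono {K L : PreAbstractSimplicialComplex V} (h : K.faces ⊆ L.faces) (k : ℕ) :
    chains F K k ≤ chains F L k :=
  Finsupp.supported_mono fun _ hσ => ⟨h hσ.1, hσ.2⟩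

/-- Being a cycle is a condition on the chain alone. This lets the modular law for dimensions
compare the cycles of the two complexes. -/
theorem cycles_inf_chains {K L : PreAbstractSimplicialComplex V} (h : K.faces ⊆ L.faces) (k : ℕ) :
    cycles F L k ⊓ chains F K k = cycles F K k := by
  cases k with
  | zero => exact inf_eq_right.2 (chains_mono F h 0)
  | succ k =>
    change (chains F L (k + 1) ⊓ _) ⊓ _ = chains F K (k + 1) ⊓ _
    rw [inf_right_comm, inf_eq_right.2 (chains_mono F h (k + 1))]

theorem bettiNumber_add_finrank_boundaries {K : PreAbstractSimplicialComplex V}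
    (hK : K.faces.Finite) (k : ℕ) :
    bettiNumber F K k + Module.finrank F (boundaries F K k) = Module.finrank F (cycles F K k) := by
  have := finite_chains F hK k
  have : FiniteDimensional F (cycles F K k) :=
    Submodule.finiteDimensional_of_le (cycles_le_chains F K k)
  have h := Submodule.finrank_quotient_add_finrank (R := F) (M := cycles F K k)
    ((boundaries F K k).submoduleOf (cycles F K k))
  rw [← h, bettiNumber, quotientDim]
  congr 1
  exact (Submodule.submoduleOfEquivOfLe (boundaries_le_cycles F K k)).finrank_eq.symm

theorem bettiNumber_le_card {K : PreAbstractSimplicialComplex V} (hK : K.faces.Finite) (k : ℕ) :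
    bettiNumber F K k ≤ K.faces.ncard := by
  have := finite_chains F hK k
  calc bettiNumber F K k ≤ Module.finrank F (cycles F K k) := by
        rw [← bettiNumber_add_finrank_boundaries F hK k]; exact Nat.le_add_right _ _
    _ ≤ Module.finrank F (chains F K k) := Submodule.finrank_mono (cycles_le_chains F K k)
    _ ≤ _ := by
        rw [finrank_chains F hK]
        exact Set.ncard_le_ncard (fun σ hσ => hσ.1) hK

theorem finrank_chains_le {K L : PreAbstractSimplicialComplex V} (h : K.faces ⊆ L.faces)
    (hL : L.faces.Finite) (k : ℕ) :
    Module.finrank F (chains F L k) ≤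
      Module.finrank F (chains F K k) + (L.faces \ K.faces).ncard := by
  rw [finrank_chains F hL, finrank_chains F (hL.subset h)]
  refine (Set.ncard_le_ncard (fun σ hσ => ?_) ?_).trans (Set.ncard_union_le _ _)
  · by_cases hσK : σ ∈ K.faces
    · exact Or.inl ⟨hσK, hσ.2⟩
    · exact Or.inr ⟨hσ.1, hσK⟩
  · exact (hL.subset fun σ hσ => h hσ.1).union (hL.subset fun σ hσ => hσ.1)

/-- Adding simplices to a finite complex changes each Betti number by at most the number of
added simplices. -/
theorem abs_bettiNumber_sub_le {K L : PreAbstractSimplicialComplex V} (h : K.faces ⊆ L.faces)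
    (hL : L.faces.Finite) (k : ℕ) :
    |(bettiNumber F L k : ℤ) - bettiNumber F K k| ≤ (L.faces \ K.faces).ncard := by
  have hK := hL.subset h
  have fL := finite_chains F hL
  have fK := finite_chains F hK
  have fZL : FiniteDimensional F (cycles F L k) :=
    Submodule.finiteDimensional_of_le (cycles_le_chains F L k)
  have fBL : FiniteDimensional F (boundaries F L k) :=
    Submodule.finiteDimensional_of_le (boundaries_le_cycles F L k)
  have eL := bettiNumber_add_finrank_boundaries F hL k
  have eK := bettiNumber_add_finrank_boundaries F hK k
  have c1 := finrank_chains_le F h hL k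
  have c2 := finrank_chains_le F h hL (k + 1)
  have z1 : Module.finrank F (cycles F K k) ≤ Module.finrank F (cycles F L k) := by
    rw [← cycles_inf_chains F h k]; exact Submodule.finrank_mono inf_le_left
  -- The modular law bounds the growth of the cycle space by that of the `k`-chains.
  have z2 := Submodule.finrank_sup_add_finrank_inf_eq (cycles F L k) (chains F K k)
  rw [cycles_inf_chains F h k] at z2
  have z3 : Module.finrank F ↥(cycles F L k ⊔ chains F K k) ≤ Module.finrank F (chains F L k) :=
    Submodule.finrank_mono (sup_le (cycles_le_chains F L k) (chains_mono F h k))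
  have b1 : Module.finrank F (boundaries F K k) ≤ Module.finrank F (boundaries F L k) :=
    Submodule.finrank_mono (Submodule.map_mono (chains_mono F h (k + 1)))
  -- Rank-nullity bounds the growth of the boundary space by that of the `(k + 1)`-chains. Both
  -- spaces grow by a number between zero and the number of new simplices, hence so does, in
  -- absolute value, the difference of their dimensions.
  have rn : ∀ M : PreAbstractSimplicialComplex V, FiniteDimensional F (chains F M (k + 1)) →
      Module.finrank F (boundaries F M k) +
        Module.finrank F ↥(chains F M (k + 1) ⊓ LinearMap.ker (boundary F)) =
        Module.finrank F (chains F M (k + 1)) := by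
    intro M hM
    have := LinearMap.finrank_range_add_finrank_ker (K := F) (V := chains F M (k + 1))
      (V₂ := Finset V →₀ F) ((boundary F).domRestrict (chains F M (k + 1)))
    rw [LinearMap.range_domRestrict, LinearMap.ker_domRestrict] at this
    rw [← this, boundaries]
    congr 1
    rw [← Submodule.finrank_map_subtype_eq, Submodule.map_comap_subtype]
  have b2 := rn L (fL _)
  have b3 := rn K (fK _)
  have b4 : Module.finrank F ↥(chains F K (k + 1) ⊓ LinearMap.ker (boundary F)) ≤
      Module.finrank F ↥(chains F L (k + 1) ⊓ LinearMap.ker (boundary F)) := by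
    have : FiniteDimensional F ↥(chains F L (k + 1) ⊓ LinearMap.ker (boundary F)) :=
      Submodule.finiteDimensional_of_le inf_le_left
    exact Submodule.finrank_mono (inf_le_inf_right _ (chains_mono F h (k + 1)))
  rw [abs_le]
  omega

end FiniteComplex

/-! ### Invariance of Betti numbers under injective maps of vertices that need not preserve the
order. -/

section Relabel

variable {V : Type*} [LinearOrder V] (F : Type*) [Field F]

/-- The pairs of vertices of `σ` whose order is reversed by `φ`. -/
def inversions (φ : V → V) (σ : Finset V) : Finset (V × V) :=
  (σ ×ˢ σ).filter fun p => p.1 < p.2 ∧ φ p.2 < φ p.1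

/-- The sign by which `φ` changes the orientation of `σ`. -/
def relabelSign (φ : V → V) (σ : Finset V) : F := (-1) ^ (inversions φ σ).card

theorem relabelSign_mul_self (φ : V → V) (σ : Finset V) :
    relabelSign F φ σ * relabelSign F φ σ = 1 := by
  rw [relabelSign, ← pow_add, Even.neg_one_pow ⟨_, rfl⟩]

/-- The parity behind the chain map property. Here `A` and `B` are the vertices whose order relative
to `v` is reversed, from below and from above, and `C` those below `v` before and after. Removing
`v` loses `A + B` inversions, while the positions of `v` and `φ v` are `A + C` and `B + C`: the
total is even. -/
theorem card_inversions {φ : V → V} {σ : Finset V} {v : V} (hv : v ∈ σ)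
    (hφ : Set.InjOn φ σ) :
    ∃ m : ℕ, (inversions φ σ).card + (σ.filter (· < v)).card
        + (((σ.erase v).image φ).filter (· < φ v)).card =
      (inversions φ (σ.erase v)).card + 2 * m := by
  classical
  set A := (σ.erase v).filter fun u => u < v ∧ φ v < φ u
  set B := (σ.erase v).filter fun u => v < u ∧ φ u < φ v
  set C := (σ.erase v).filter fun u => u < v ∧ φ u < φ v
  have hne : ∀ u ∈ σ.erase v, u ≠ v ∧ φ u ≠ φ v := fun u hu =>
    ⟨Finset.ne_of_mem_erase hu, fun h => Finset.ne_of_mem_erase hu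
      (hφ (Finset.mem_of_mem_erase hu) hv h)⟩
  have h1 : (σ.filter (· < v)).card = A.card + C.card := by
    rw [← Finset.card_union_of_disjoint]
    · congr 1
      ext u
      simp only [Finset.mem_filter, Finset.mem_union, A, C, Finset.mem_erase]
      constructor
      · rintro ⟨hu, huv⟩
        have := (hne u (Finset.mem_erase.2 ⟨huv.ne, hu⟩)).2
        rcases lt_or_gt_of_ne this with h | h
        · exact Or.inr ⟨⟨huv.ne, hu⟩, huv, h⟩
        · exact Or.inl ⟨⟨huv.ne, hu⟩, huv, h⟩
      · rintro (⟨⟨_, hu⟩, huv, _⟩ | ⟨⟨_, hu⟩, huv, _⟩) <;> exact ⟨hu, huv⟩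
    · rw [Finset.disjoint_filter]
      exact fun u _ h h' => lt_asymm h.2 h'.2
  have h2 : (((σ.erase v).image φ).filter (· < φ v)).card = B.card + C.card := by
    rw [Finset.filter_image, Finset.card_image_of_injOn, ← Finset.card_union_of_disjoint]
    · congr 1
      ext u
      simp only [Finset.mem_filter, Finset.mem_union, B, C]
      constructor
      · rintro ⟨hu, huv⟩
        rcases lt_or_gt_of_ne (hne u hu).1 with h | h
        · exact Or.inr ⟨hu, h, huv⟩
        · exact Or.inl ⟨hu, h, huv⟩
      · rintro (⟨hu, _, huv⟩ | ⟨hu, _, huv⟩) <;> exact ⟨hu, huv⟩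
    · rw [Finset.disjoint_filter]
      exact fun u _ h h' => lt_asymm h.1 h'.1
    · refine hφ.mono fun u hu => ?_
      simp only [Finset.coe_filter, Set.mem_ofPred_eq] at hu
      exact Finset.mem_of_mem_erase hu.1
  have h3 : (inversions φ σ).card = (inversions φ (σ.erase v)).card + (A.card + B.card) := by
    have e : inversions φ σ = inversions φ (σ.erase v) ∪
        (A.image (fun u => (u, v)) ∪ B.image (fun u => (v, u))) := by
      ext ⟨a, b⟩
      simp only [inversions, A, B, Finset.mem_filter, Finset.mem_union, Finset.mem_image,
        Finset.mem_product, Finset.mem_erase, Prod.mk.injEq]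
      constructor
      · rintro ⟨⟨ha, hb⟩, hab, hf⟩
        by_cases hbv : b = v
        · subst hbv
          exact Or.inr (Or.inl ⟨a, ⟨⟨hab.ne, ha⟩, hab, hf⟩, rfl, rfl⟩)
        · by_cases hav : a = v
          · subst hav
            exact Or.inr (Or.inr ⟨b, ⟨⟨hbv, hb⟩, hab, hf⟩, rfl, rfl⟩)
          · exact Or.inl ⟨⟨⟨hav, ha⟩, hbv, hb⟩, hab, hf⟩
      · rintro (⟨⟨⟨_, ha⟩, _, hb⟩, h⟩ | ⟨u, ⟨⟨_, hu⟩, h⟩, rfl, rfl⟩ | ⟨u, ⟨⟨_, hu⟩, h⟩, rfl, rfl⟩)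
        · exact ⟨⟨ha, hb⟩, h⟩
        · exact ⟨⟨hu, hv⟩, h⟩
        · exact ⟨⟨hv, hu⟩, h⟩
    rw [e, Finset.card_union_of_disjoint, Finset.card_union_of_disjoint,
      Finset.card_image_of_injective, Finset.card_image_of_injective]
    · exact fun a b h => (Prod.mk.inj h).2
    · exact fun a b h => (Prod.mk.inj h).1
    · rw [Finset.disjoint_left]
      rintro ⟨a, b⟩ h h'
      simp only [Finset.mem_image, Prod.mk.injEq, A, B, Finset.mem_filter] at h h'
      obtain ⟨u, ⟨hu, _⟩, rfl, rfl⟩ := h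
      obtain ⟨w, ⟨_, _⟩, h1, h2⟩ := h'
      exact (hne _ hu).1 h1.symm
    · rw [Finset.disjoint_left]
      rintro ⟨a, b⟩ h h'
      simp only [inversions, Finset.mem_filter, Finset.mem_product] at h
      simp only [Finset.mem_union, Finset.mem_image, Prod.mk.injEq] at h'
      rcases h' with ⟨u, _, rfl, rfl⟩ | ⟨u, _, rfl, rfl⟩
      · exact (hne _ h.1.2).1 rfl
      · exact (hne _ h.1.1).1 rfl
  exact ⟨A.card + B.card + C.card, by omega⟩

/-- The chain map induced by a map of vertices, for the simplices on which it is injective. -/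
def relabel (φ : V → V) : (Finset V →₀ F) →ₗ[F] (Finset V →₀ F) :=
  Finsupp.linearCombination F fun σ : Finset V =>
    Finsupp.single (σ.image φ) (relabelSign F φ σ)

theorem relabel_single (φ : V → V) (σ : Finset V) (a : F) :
    relabel F φ (Finsupp.single σ a) = Finsupp.single (σ.image φ) (a * relabelSign F φ σ) := by
  simp [relabel]

theorem relabel_boundary_single {φ : V → V} {σ : Finset V} (hφ : Set.InjOn φ σ) (a : F) :
    boundary F (relabel F φ (Finsupp.single σ a)) =
      relabel F φ (boundary F (Finsupp.single σ a)) := by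
  classical
  rw [relabel_single, boundary_single, boundary_single, map_sum, Finset.sum_image hφ]
  refine Finset.sum_congr rfl fun v hv => ?_
  have he : (σ.image φ).erase (φ v) = (σ.erase v).image φ := by
    ext w
    simp only [Finset.mem_erase, Finset.mem_image]
    constructor
    · rintro ⟨h, u, hu, rfl⟩
      exact ⟨u, ⟨fun e => h (by rw [e]), hu⟩, rfl⟩
    · rintro ⟨u, ⟨h, hu⟩, rfl⟩
      exact ⟨fun e => h (hφ hu hv e), u, hu, rfl⟩
  rw [relabel_single, he]
  congr 1
  have hf : (σ.image φ).filter (· < φ v) = ((σ.erase v).image φ).filter (· < φ v) := by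
    rw [← he]
    ext w
    simp only [Finset.mem_filter, Finset.mem_erase]
    exact ⟨fun h => ⟨⟨h.2.ne, h.1⟩, h.2⟩, fun h => ⟨h.1.2, h.2⟩⟩
  rw [hf, mul_assoc, mul_assoc]
  congr 1
  obtain ⟨m, hm⟩ := card_inversions hv hφ
  have hp : ((-1 : F)) ^ ((inversions φ σ).card + (σ.filter (· < v)).card
        + (((σ.erase v).image φ).filter (· < φ v)).card) =
      (-1) ^ (inversions φ (σ.erase v)).card := by
    rw [hm, pow_add, pow_mul]; simp
  rw [relabelSign, relabelSign, ← hp, ← pow_add, ← pow_add]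
  have hev : (-1 : F) ^ ((σ.filter (· < v)).card + (σ.filter (· < v)).card) = 1 :=
    Even.neg_one_pow ⟨_, rfl⟩
  calc _ = (-1 : F) ^ ((σ.filter (· < v)).card + (σ.filter (· < v)).card) * _ := by
        rw [hev, one_mul]
    _ = _ := by rw [← pow_add]; congr 1; omega

/-- On sets of vertices inside `S` distinct simplices have distinct images, so no two terms of the
chain merge and each coefficient survives up to sign. -/
theorem relabel_apply_image {φ : V → V} {S : Set V} (hφ : Set.InjOn φ S)
    {c : Finset V →₀ F} (hc : c ∈ Finsupp.supported F F {σ : Finset V | (σ : Set V) ⊆ S})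
    {σ : Finset V} (hσ : (σ : Set V) ⊆ S) :
    relabel F φ c (σ.image φ) = c σ * relabelSign F φ σ := by
  classical
  rw [relabel, Finsupp.linearCombination_apply, Finsupp.sum, Finsupp.finsetSum_apply]
  rw [Finset.sum_eq_single σ]
  · simp
  · intro τ hτ hne
    rw [Finsupp.smul_single, Finsupp.single_apply, if_neg]
    intro h
    apply hne
    have hτS : (τ : Set V) ⊆ S := (Finsupp.mem_supported F c).1 hc hτ
    apply Finset.coe_injective
    apply hφ.image_eq_image_iff hτS hσ |>.1
    exact_mod_cast congrArg (fun s : Finset V => (s : Set V)) h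
  · intro h
    simp [Finsupp.notMem_support_iff.1 h]

theorem relabel_injOn {φ : V → V} {S : Set V} (hφ : Set.InjOn φ S) :
    Set.InjOn (relabel F φ) (Finsupp.supported F F {σ : Finset V | (σ : Set V) ⊆ S}) := by
  intro c hc c' hc' h
  ext σ
  by_cases hσ : (σ : Set V) ⊆ S
  · have := relabel_apply_image F hφ hc hσ
    rw [h, relabel_apply_image F hφ hc' hσ] at this
    have h2 := congrArg (· * relabelSign F φ σ) this
    simpa [mul_assoc, relabelSign_mul_self] using h2.symm
  · have aux : ∀ e ∈ Finsupp.supported F F {σ : Finset V | (σ : Set V) ⊆ S}, e σ = 0 := by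
      intro e he
      by_contra h0
      exact hσ ((Finsupp.mem_supported F e).1 he (Finsupp.mem_support_iff.2 h0))
    rw [aux c hc, aux c' hc']

theorem finrank_map_relabel {φ : V → V} {S : Set V} (hφ : Set.InjOn φ S)
    {p : Submodule F (Finset V →₀ F)}
    (hp : p ≤ Finsupp.supported F F {σ : Finset V | (σ : Set V) ⊆ S}) :
    Module.finrank F (p.map (relabel F φ)) = Module.finrank F p := by
  rw [← LinearMap.range_domRestrict]
  refine LinearMap.finrank_range_of_inj ?_
  intro x y h
  exact Subtype.ext (relabel_injOn F hφ (hp x.2) (hp y.2) h)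

theorem relabel_boundary {φ : V → V} {S : Set V} (hφ : Set.InjOn φ S) {c : Finset V →₀ F}
    (hc : c ∈ Finsupp.supported F F {σ : Finset V | (σ : Set V) ⊆ S}) :
    boundary F (relabel F φ c) = relabel F φ (boundary F c) := by
  rw [Finsupp.supported_eq_span_single] at hc
  induction hc using Submodule.span_induction with
  | mem x h =>
    obtain ⟨σ, hσ, rfl⟩ := h
    exact relabel_boundary_single F (hφ.mono hσ) 1
  | zero => simp
  | add x y _ _ hx hy => simp only [map_add, hx, hy]
  | smul a x _ hx => simp only [map_smul, hx]

theorem map_relabel_chains (φ : V → V) {S : Set V} (hφ : Set.InjOn φ S)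
    {K L : PreAbstractSimplicialComplex V} (hK : ∀ σ ∈ K.faces, (σ : Set V) ⊆ S)
    (hL : ∀ τ, τ ∈ L.faces ↔ ∃ σ ∈ K.faces, σ.image φ = τ) (k : ℕ) :
    (chains F K k).map (relabel F φ) = chains F L k := by
  classical
  apply le_antisymm
  · rw [chains, Finsupp.supported_eq_span_single, Submodule.map_span, Submodule.span_le]
    rintro _ ⟨_, ⟨σ, ⟨hσ, hcard⟩, rfl⟩, rfl⟩
    rw [relabel_single]
    refine Finsupp.single_mem_supported F _ ⟨(hL _).2 ⟨σ, hσ, rfl⟩, ?_⟩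
    rw [Finset.card_image_of_injOn (hφ.mono (hK σ hσ)), hcard]
  · rw [chains, chains, Finsupp.supported_eq_span_single, Submodule.span_le]
    rintro _ ⟨τ, ⟨hτ, hcard⟩, rfl⟩
    obtain ⟨σ, hσ, rfl⟩ := (hL τ).1 hτ
    refine ⟨Finsupp.single σ (relabelSign F φ σ), Finsupp.single_mem_supported F _ ⟨hσ, ?_⟩, ?_⟩
    · rwa [Finset.card_image_of_injOn (hφ.mono (hK σ hσ))] at hcard
    · rw [relabel_single, relabelSign_mul_self]

/-- Betti numbers are invariant under relabelling the vertices. -/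
theorem bettiNumber_relabel (φ : V → V) {S : Set V} (hφ : Set.InjOn φ S)
    {K L : PreAbstractSimplicialComplex V} (hK : ∀ σ ∈ K.faces, (σ : Set V) ⊆ S)
    (hL : ∀ τ, τ ∈ L.faces ↔ ∃ σ ∈ K.faces, σ.image φ = τ) (hfin : K.faces.Finite) (k : ℕ) :
    bettiNumber F L k = bettiNumber F K k := by
  classical
  have hfinL : L.faces.Finite := by
    refine (hfin.image (Finset.image φ)).subset fun τ hτ => ?_
    obtain ⟨σ, hσ, rfl⟩ := (hL τ).1 hτ
    exact ⟨σ, hσ, rfl⟩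
  have hC : ∀ k, chains F K k ≤ Finsupp.supported F F {σ : Finset V | (σ : Set V) ⊆ S} :=
    fun k => Finsupp.supported_mono fun σ hσ => hK σ hσ.1
  have hB : boundaries F L k = (boundaries F K k).map (relabel F φ) := by
    rw [boundaries, boundaries, ← map_relabel_chains F φ hφ hK hL]
    ext c
    simp only [Submodule.mem_map, exists_exists_and_eq_and]
    constructor
    · rintro ⟨a, ha, rfl⟩
      exact ⟨a, ha, (relabel_boundary F hφ (hC _ ha)).symm⟩
    · rintro ⟨a, ha, rfl⟩
      exact ⟨a, ha, relabel_boundary F hφ (hC _ ha)⟩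
  have hZ : cycles F L k = (cycles F K k).map (relabel F φ) := by
    cases k with
    | zero => exact (map_relabel_chains F φ hφ hK hL 0).symm
    | succ k =>
      rw [cycles, cycles, ← map_relabel_chains F φ hφ hK hL]
      have hsub : ∀ a ∈ chains F K (k + 1), boundary F a ∈ chains F K k := fun a ha => by
        have := (boundaries_le_cycles F K k).trans (cycles_le_chains F K k)
        exact this ⟨a, ha, rfl⟩
      ext c
      simp only [Submodule.mem_map, Submodule.mem_inf, LinearMap.mem_ker]
      constructor
      · rintro ⟨⟨a, ha, rfl⟩, h0⟩
        rw [relabel_boundary F hφ (hC _ ha)] at h0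
        refine ⟨a, ⟨ha, ?_⟩, rfl⟩
        exact relabel_injOn F hφ (hC _ (hsub a ha)) (Submodule.zero_mem _) (by rw [h0, map_zero])
      · rintro ⟨a, ⟨ha, h0⟩, rfl⟩
        refine ⟨⟨a, ha, rfl⟩, ?_⟩
        rw [relabel_boundary F hφ (hC _ ha), h0, map_zero]
  have eL := bettiNumber_add_finrank_boundaries F hfinL k
  have eK := bettiNumber_add_finrank_boundaries F hfin k
  rw [hB, hZ, finrank_map_relabel F hφ ((cycles_le_chains F K k).trans (hC k)),
    finrank_map_relabel F hφ
      ((boundaries_le_cycles F K k).trans ((cycles_le_chains F K k).trans (hC k)))] at eL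
  omega

end Relabel

/-! ### Locality and stability of the Čech complex. -/

section Cech

variable {E : Type*} [MetricSpace E] [LinearOrder E] (F : Type*) [Field F]

theorem mem_cechComplex {X : Set E} {r : ℝ} {σ : Finset E} :
    σ ∈ (cechComplex X r).faces ↔
      σ.Nonempty ∧ (σ : Set E) ⊆ X ∧ ∃ z, ∀ x ∈ σ, dist z x ≤ r := by
  simp [cechComplex, Set.Nonempty]

theorem faces_cechComplex_subset (S : Finset E) (r : ℝ) :
    (cechComplex (S : Set E) r).faces ⊆ S.powerset := fun _ hσ =>
  Finset.mem_coe.2 (Finset.mem_powerset.2 (Finset.coe_subset.1 (mem_cechComplex.1 hσ).2.1))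

theorem finite_faces_cechComplex (S : Finset E) (r : ℝ) :
    (cechComplex (S : Set E) r).faces.Finite :=
  S.powerset.finite_toSet.subset (faces_cechComplex_subset S r)

theorem bettiNumber_cechComplex_le (k : ℕ) (S : Finset E) (r : ℝ) :
    bettiNumber F (cechComplex (S : Set E) r) k ≤ 2 ^ S.card := by
  refine (bettiNumber_le_card F (finite_faces_cechComplex S r) k).trans ?_
  rw [← Finset.card_powerset, ← Set.ncard_coe_finset]
  exact Set.ncard_le_ncard (faces_cechComplex_subset S r) S.powerset.finite_toSet

/-- Adding a point to a finite set changes the Betti numbers of its Čech complex by at most the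
number of sets of points close to the new one. -/
theorem abs_bettiNumber_insert_sub_le (k : ℕ) (S : Finset E) (y : E) (r : ℝ) :
    |(bettiNumber F (cechComplex (insert y (S : Set E)) r) k : ℤ) -
      bettiNumber F (cechComplex (S : Set E) r) k| ≤
      2 ^ (S.filter fun x => dist x y ≤ 2 * r).card := by
  classical
  rw [← Finset.coe_insert]
  have hsub : (cechComplex (S : Set E) r).faces ⊆
      (cechComplex ((insert y S : Finset E) : Set E) r).faces := by
    intro σ hσ
    rw [mem_cechComplex] at hσ ⊢
    exact ⟨hσ.1, hσ.2.1.trans (Finset.coe_subset.2 (Finset.subset_insert y S)), hσ.2.2⟩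
  refine (abs_bettiNumber_sub_le F hsub (finite_faces_cechComplex _ r) k).trans ?_
  -- A new simplex contains `y`, and a common point of the balls puts its other vertices within `2 *
  -- r` of `y`. Erasing `y` is injective on such simplices.
  have hnew : ∀ σ ∈ (cechComplex ((insert y S : Finset E) : Set E) r).faces \
      (cechComplex (S : Set E) r).faces, y ∈ σ ∧
      σ.erase y ∈ (S.filter fun x => dist x y ≤ 2 * r).powerset := by
    rintro σ ⟨h1, h2⟩
    rw [mem_cechComplex] at h1 h2
    obtain ⟨hne, hsub, z, hz⟩ := h1
    have hy : y ∈ σ := by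
      by_contra hy
      refine h2 ⟨hne, fun x hx => ?_, z, hz⟩
      rcases Finset.mem_insert.1 (Finset.mem_coe.1 (hsub hx)) with rfl | h
      · exact absurd hx hy
      · exact h
    refine ⟨hy, Finset.mem_powerset.2 fun x hx => ?_⟩
    rw [Finset.mem_erase] at hx
    rw [Finset.mem_filter]
    refine ⟨(Finset.mem_insert.1 (Finset.mem_coe.1 (hsub hx.2))).resolve_left hx.1, ?_⟩
    have := dist_triangle_left x y z
    linarith [hz x hx.2, hz y hy]
  have hle : ((cechComplex ((insert y S : Finset E) : Set E) r).faces \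
      (cechComplex (S : Set E) r).faces).ncard ≤
      ((S.filter fun x => dist x y ≤ 2 * r).powerset : Set (Finset E)).ncard :=
    Set.ncard_le_ncard_of_injOn (fun σ => σ.erase y) (fun σ hσ => (hnew σ hσ).2)
      (fun σ hσ τ hτ h => by
        rw [← Finset.insert_erase (hnew σ hσ).1, ← Finset.insert_erase (hnew τ hτ).1]
        exact congrArg (insert y) h) (Finset.finite_toSet _)
  rw [Set.ncard_coe_finset, Finset.card_powerset] at hle
  exact_mod_cast hle

/-- If closed balls of radius `r` have no common point, then neither have slightly larger ones. -/
theorem eventually_no_common_point [ProperSpace E] {σ : Finset E} (hne : σ.Nonempty) {r : ℝ}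
    (h : ¬ ∃ z, ∀ x ∈ σ, dist z x ≤ r) :
    ∀ᶠ ε in 𝓝[>] (0 : ℝ), ¬ ∃ z, ∀ x ∈ σ, dist z x ≤ r + ε := by
  obtain ⟨x₀, hx₀⟩ := hne
  by_contra hcon
  apply h
  have hall : ∀ ε > 0, ∃ z, ∀ x ∈ σ, dist z x ≤ r + ε := by
    by_contra! hε
    obtain ⟨ε, hε, hz⟩ := hε
    apply hcon
    filter_upwards [Ioo_mem_nhdsGT hε] with δ hδ
    rintro ⟨z, hz'⟩
    obtain ⟨x, hx, hlt⟩ := hz z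
    linarith [hz' x hx, hδ.2]
  choose z hz using fun n : ℕ => hall (1 / ((n : ℝ) + 1)) Nat.one_div_pos_of_nat
  have hmem : ∀ n, z n ∈ Metric.closedBall x₀ (r + 1) := fun n => by
    have h1 := hz n x₀ hx₀
    have h2 : 1 / ((n : ℝ) + 1) ≤ 1 := by
      rw [div_le_one (by positivity)]; linarith [Nat.cast_nonneg (α := ℝ) n]
    exact Metric.mem_closedBall.2 (by linarith)
  obtain ⟨a, -, φ, hφ, hlim⟩ := (isCompact_closedBall x₀ (r + 1)).tendsto_subseq hmem
  refine ⟨a, fun x hx => ?_⟩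
  have h1 : Tendsto (fun n => r + 1 / ((φ n : ℝ) + 1)) atTop (𝓝 (r + 0)) :=
    tendsto_const_nhds.add (tendsto_one_div_add_atTop_nhds_zero_nat.comp hφ.tendsto_atTop)
  rw [add_zero] at h1
  exact le_of_tendsto_of_tendsto' (hlim.dist tendsto_const_nhds) h1 fun n => hz (φ n) x hx

/-- Betti numbers of Čech complexes are stable under small perturbations of the points, if the
radius is slightly increased. -/
theorem eventually_bettiNumber_image_eq [ProperSpace E] (k : ℕ) (S : Finset E) (r : ℝ)
    {p : ℕ → E → E} (hp : ∀ x ∈ S, Tendsto (fun N => p N x) atTop (𝓝 x)) :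
    ∀ᶠ ε in 𝓝[>] (0 : ℝ), ∀ᶠ N in atTop,
      bettiNumber F (cechComplex ((S.image (p N) : Finset E) : Set E) (r + ε)) k =
        bettiNumber F (cechComplex (S : Set E) r) k := by
  classical
  -- The slack is `2 * ε`: one `ε` for the larger radius and one for the displacement of the points.
  -- There are finitely many subsets to consider.
  have h1 : ∀ᶠ ε in 𝓝[>] (0 : ℝ), ∀ σ ∈ S.powerset, σ.Nonempty →
      (∃ z, ∀ x ∈ σ, dist z x ≤ r + 2 * ε) → ∃ z, ∀ x ∈ σ, dist z x ≤ r := by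
    rw [Filter.eventually_all_finset]
    intro σ _
    by_cases hne : σ.Nonempty
    · by_cases h : ∃ z, ∀ x ∈ σ, dist z x ≤ r
      · exact Eventually.of_forall fun _ _ _ => h
      · have ht : Tendsto (fun ε : ℝ => 2 * ε) (𝓝[>] 0) (𝓝[>] 0) := by
          refine tendsto_nhdsWithin_iff.2 ⟨?_, ?_⟩
          · have : Tendsto (fun ε : ℝ => 2 * ε) (𝓝 0) (𝓝 (2 * 0)) :=
              tendsto_const_nhds.mul tendsto_id
            rw [mul_zero] at this
            exact this.mono_left nhdsWithin_le_nhds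
          · filter_upwards [self_mem_nhdsWithin] with ε hε
            exact mul_pos two_pos (Set.mem_Ioi.1 hε)
        filter_upwards [ht.eventually (eventually_no_common_point hne h)] with ε hε _ h'
        exact absurd h' hε
    · exact Eventually.of_forall fun _ h => absurd h hne
  filter_upwards [h1, self_mem_nhdsWithin] with ε hε hε0
  rw [Set.mem_Ioi] at hε0
  have h2 : ∀ᶠ N in atTop, ∀ x ∈ S, dist (p N x) x < ε := by
    rw [Filter.eventually_all_finset]
    exact fun x hx => (hp x hx).eventually (Metric.ball_mem_nhds x hε0)
  have h3 : ∀ᶠ N in atTop, ∀ x ∈ S, ∀ y ∈ S, x ≠ y → p N x ≠ p N y := by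
    rw [Filter.eventually_all_finset]
    intro x hx
    rw [Filter.eventually_all_finset]
    intro y hy
    by_cases hxy : x = y
    · exact Eventually.of_forall fun _ h => absurd hxy h
    · have := ((hp x hx).prodMk_nhds (hp y hy)).eventually
        ((isOpen_ne_fun continuous_fst continuous_snd).mem_nhds hxy)
      exact this.mono fun _ h _ => h
  filter_upwards [h2, h3] with N hN hinj
  have hinj' : Set.InjOn (p N) (S : Set E) := fun x hx y hy h => by
    by_contra hxy
    exact hinj x hx y hy hxy h
  refine bettiNumber_relabel F (p N) hinj' (fun σ hσ => (mem_cechComplex.1 hσ).2.1) ?_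
    (finite_faces_cechComplex S r) k
  intro τ
  constructor
  · intro hτ
    obtain ⟨hne, hsub, z, hz⟩ := mem_cechComplex.1 hτ
    have him : (S.filter fun x => p N x ∈ τ).image (p N) = τ := by
      ext w
      simp only [Finset.mem_image, Finset.mem_filter]
      constructor
      · rintro ⟨x, ⟨_, hx⟩, rfl⟩
        exact hx
      · intro hw
        obtain ⟨x, hx, rfl⟩ := Finset.mem_image.1 (Finset.mem_coe.1 (hsub hw))
        exact ⟨x, ⟨hx, hw⟩, rfl⟩
    have hne' : (S.filter fun x => p N x ∈ τ).Nonempty := by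
      rw [← him] at hne
      exact Finset.image_nonempty.1 hne
    refine ⟨_, mem_cechComplex.2 ⟨hne', Finset.coe_subset.2 (Finset.filter_subset _ _), ?_⟩, him⟩
    refine hε _ (Finset.mem_powerset.2 (Finset.filter_subset _ _)) hne' ⟨z, fun x hx => ?_⟩
    rw [Finset.mem_filter] at hx
    have := dist_triangle z (p N x) x
    linarith [hz _ hx.2, hN x hx.1]
  · rintro ⟨σ, hσ, rfl⟩
    obtain ⟨hne, hsub, z, hz⟩ := mem_cechComplex.1 hσ
    refine mem_cechComplex.2 ⟨hne.image _, ?_, z, ?_⟩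
    · rw [Finset.coe_image, Finset.coe_image]
      exact Set.image_mono hsub
    · intro w hw
      obtain ⟨x, hx, rfl⟩ := Finset.mem_image.1 hw
      have := dist_triangle_right z (p N x) x
      have := dist_comm (p N x) x
      linarith [hz x hx, hN x (hsub hx)]

end Cech

/-! ### The space of finite configurations -/

/-- Finite sets of points of `E`, measured by the events that a Borel set contains no point. -/
@[ext]
structure Configuration (E : Type*) where
  /-- The points of the configuration. -/
  points : Finset E

section Configuration

variable {E : Type*} [MeasurableSpace E]

/-- The configurations without points in `B`. -/
def voidEvent (B : Set E) : Set (Configuration E) :=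
  {S | ∀ x ∈ S.points, x ∉ B}

/-- Void events form a π-system, so void probabilities determine a law. They also suffice to make
the Betti numbers measurable. -/
instance : MeasurableSpace (Configuration E) :=
  MeasurableSpace.generateFrom {A | ∃ B : Set E, MeasurableSet B ∧ voidEvent B = A}

theorem measurableSet_voidEvent {B : Set E} (hB : MeasurableSet B) :
    MeasurableSet (voidEvent B) :=
  MeasurableSpace.measurableSet_generateFrom ⟨B, hB, rfl⟩

theorem isPiSystem_voidEvent :
    IsPiSystem {A : Set (Configuration E) | ∃ B : Set E, MeasurableSet B ∧ voidEvent B = A} := by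
  rintro _ ⟨B, hB, rfl⟩ _ ⟨C, hC, rfl⟩ _
  refine ⟨B ∪ C, hB.union hC, ?_⟩
  ext S
  change (∀ x ∈ S.points, x ∉ B ∪ C) ↔ (∀ x ∈ S.points, x ∉ B) ∧
    ∀ x ∈ S.points, x ∉ C
  simp only [Set.mem_union, not_or]
  exact ⟨fun h => ⟨fun x hx => (h x hx).1, fun x hx => (h x hx).2⟩,
    fun h x hx => ⟨h.1 x hx, h.2 x hx⟩⟩

theorem measurable_toConfiguration {Ω : Type*} [MeasurableSpace Ω] {Φ : Ω → Configuration E}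
    (h : ∀ B, MeasurableSet B → MeasurableSet (Φ ⁻¹' voidEvent B)) : Measurable Φ := by
  refine measurable_generateFrom ?_
  rintro _ ⟨B, hB, rfl⟩
  exact h B hB

/-- Laws of random configurations are determined by their void probabilities. -/
theorem configuration_measure_ext {μ ν : Measure (Configuration E)} [IsProbabilityMeasure μ]
    [IsProbabilityMeasure ν]
    (h : ∀ B, MeasurableSet B → μ (voidEvent B) = ν (voidEvent B)) : μ = ν := by
  refine ext_of_generate_finite _ rfl isPiSystem_voidEvent ?_ (by simp)
  rintro _ ⟨B, hB, rfl⟩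
  exact h B hB

/-- Functions of the image of a configuration under a simple function are measurable. -/
theorem measurable_comp_image [DecidableEq E] {β : Type*} [MeasurableSpace β]
    (p : SimpleFunc E E) (G : Finset E → β) :
    Measurable fun S : Configuration E => G (Finset.image p S.points) := by
  classical
  have hsub : ∀ S : Finset E, S.image p ⊆ p.range := fun S w hw => by
    obtain ⟨x, _, rfl⟩ := Finset.mem_image.1 hw
    exact p.mem_range_self x
  -- The image is determined by which of the finitely many values of `p` are attained, and attaining
  -- a value is the complement of a void event.
  let I : Configuration E → (p.range → Prop) := fun S t => (t : E) ∈ Finset.image p S.points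
  have hI : Measurable I := by
    refine measurable_pi_iff.2 fun t => measurable_to_prop ?_
    have : (fun S => I S t) ⁻¹' {True} = (voidEvent (p ⁻¹' {(t : E)}))ᶜ := by
      ext S
      simp only [Set.mem_preimage, Set.mem_singleton_iff, eq_iff_iff, iff_true, Set.mem_compl_iff]
      change (t : E) ∈ Finset.image p S.points ↔ ¬ ∀ x ∈ S.points, p x ≠ t
      rw [Finset.mem_image]
      push Not
      rfl
    rw [this]
    exact (measurableSet_voidEvent (p.measurableSet_fiber _)).compl
  let J : (p.range → Prop) → Finset E := fun s => p.range.filter fun w => ∃ h, s ⟨w, h⟩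
  have hJ : ∀ S : Configuration E, Finset.image p S.points = J (I S) := fun S => by
    ext w
    simp only [J, Finset.mem_filter]
    exact ⟨fun h => ⟨hsub S.points h, hsub S.points h, h⟩, fun h => h.2.2⟩
  simp only [hJ]
  exact (Measurable.of_discrete (f := fun s => G (J s))).comp hI

end Configuration

/-- The Betti numbers of Čech complexes are random variables. -/
theorem measurable_bettiNumber_cechComplex {E : Type*} [MetricSpace E] [LinearOrder E]
    [ProperSpace E] [Nonempty E] [MeasurableSpace E] [BorelSpace E] (F : Type*) [Field F] (k : ℕ)
    (r : ℝ) :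
    Measurable fun S : Configuration E =>
      (bettiNumber F (cechComplex (S.points : Set E) r) k : ℝ) := by
  classical
  let e := TopologicalSpace.denseSeq E
  let p : ℕ → SimpleFunc E E := SimpleFunc.nearestPt e
  have hp : ∀ x, Tendsto (fun N => p N x) atTop (𝓝 x) := fun x =>
    SimpleFunc.tendsto_nearestPt (by
      rw [(TopologicalSpace.denseRange_denseSeq E).closure_range]; trivial)
  have hε : Tendsto (fun i : ℕ => 1 / ((i : ℝ) + 1)) atTop (𝓝[>] 0) :=
    tendsto_nhdsWithin_iff.2 ⟨tendsto_one_div_add_atTop_nhds_zero_nat,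
      Eventually.of_forall fun i => Set.mem_Ioi.2 Nat.one_div_pos_of_nat⟩
  -- The order of limits matters: for a fixed small enlargement of the radius, the rounding must
  -- become fine enough. The values lie in `ENNReal`, where lower limits need no boundedness.
  let G : ℕ → ℕ → Configuration E → ENNReal := fun i N S =>
    (bettiNumber F (cechComplex ((Finset.image (p N) S.points : Finset E) : Set E)
      (r + 1 / ((i : ℝ) + 1))) k : ENNReal)
  have hG : ∀ i N, Measurable (G i N) := fun i N =>
    measurable_comp_image (p N) fun S =>
      (bettiNumber F (cechComplex (S : Set E) (r + 1 / ((i : ℝ) + 1))) k : ENNReal)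
  have hlim : (fun S : Configuration E =>
      (bettiNumber F (cechComplex (S.points : Set E) r) k : ENNReal)) =
      fun S => liminf (fun i => liminf (fun N => G i N S) atTop) atTop := by
    funext S
    symm
    have := hε.eventually (eventually_bettiNumber_image_eq F k S.points r
      (p := fun N => p N) (fun x _ => hp x))
    refine (liminf_congr (v := fun _ => (bettiNumber F
      (cechComplex (S.points : Set E) r) k : ENNReal)) ?_).trans (liminf_const _)
    filter_upwards [this] with i hi
    refine (liminf_congr (v := fun _ => (bettiNumber F
      (cechComplex (S.points : Set E) r) k : ENNReal)) ?_).trans (liminf_const _)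
    filter_upwards [hi] with N hN
    simp only [G]
    rw [← hN]
  have hm : Measurable fun S : Configuration E =>
      (bettiNumber F (cechComplex (S.points : Set E) r) k : ENNReal) := by
    rw [hlim]
    exact Measurable.liminf fun i => Measurable.liminf fun N => hG i N
  simpa using hm.ennreal_toReal

/-! ### Fourth moments of functions of independent variables -/

/-- Bounded measurable real functions. -/
structure BoundedMeasurable {X : Type*} [MeasurableSpace X] (u : X → ℝ) : Prop where
  measurable : Measurable u
  bounded : ∃ B, ∀ x, |u x| ≤ B

namespace BoundedMeasurable

variable {X Y : Type*} [MeasurableSpace X] [MeasurableSpace Y] {u v : X → ℝ}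

theorem integrable (hu : BoundedMeasurable u) (μ : Measure X) [IsFiniteMeasure μ] :
    Integrable u μ := by
  obtain ⟨B, hB⟩ := hu.bounded
  exact Integrable.of_bound hu.measurable.aestronglyMeasurable B (Eventually.of_forall hB)

theorem const (c : ℝ) : BoundedMeasurable fun _ : X => c := ⟨measurable_const, |c|, fun _ => le_rfl⟩

theorem comp (hu : BoundedMeasurable u) {f : Y → X} (hf : Measurable f) :
    BoundedMeasurable fun y => u (f y) :=
  ⟨hu.measurable.comp hf, hu.bounded.imp fun _ h y => h (f y)⟩

theorem sub (hu : BoundedMeasurable u) (hv : BoundedMeasurable v) :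
    BoundedMeasurable fun x => u x - v x := by
  obtain ⟨B, hB⟩ := hu.bounded
  obtain ⟨C, hC⟩ := hv.bounded
  exact ⟨hu.measurable.sub hv.measurable, B + C, fun x =>
    (abs_sub _ _).trans (add_le_add (hB x) (hC x))⟩

theorem add (hu : BoundedMeasurable u) (hv : BoundedMeasurable v) :
    BoundedMeasurable fun x => u x + v x := by
  obtain ⟨B, hB⟩ := hu.bounded
  obtain ⟨C, hC⟩ := hv.bounded
  exact ⟨hu.measurable.add hv.measurable, B + C, fun x =>
    (abs_add_le _ _).trans (add_le_add (hB x) (hC x))⟩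

theorem mul (hu : BoundedMeasurable u) (hv : BoundedMeasurable v) :
    BoundedMeasurable fun x => u x * v x := by
  obtain ⟨B, hB⟩ := hu.bounded
  obtain ⟨C, hC⟩ := hv.bounded
  refine ⟨hu.measurable.mul hv.measurable, B * C, fun x => ?_⟩
  rw [abs_mul]
  exact mul_le_mul (hB x) (hC x) (abs_nonneg _) ((abs_nonneg _).trans (hB x))

theorem pow (hu : BoundedMeasurable u) (n : ℕ) : BoundedMeasurable fun x => u x ^ n := by
  obtain ⟨B, hB⟩ := hu.bounded
  refine ⟨hu.measurable.pow_const n, B ^ n, fun x => ?_⟩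
  rw [abs_pow]
  exact pow_le_pow_left₀ (abs_nonneg _) (hB x) n

theorem integral_right {w : X × Y → ℝ} (hw : BoundedMeasurable w) (ν : Measure Y)
    [IsProbabilityMeasure ν] : BoundedMeasurable fun x => ∫ y, w (x, y) ∂ν := by
  obtain ⟨B, hB⟩ := hw.bounded
  refine ⟨hw.measurable.stronglyMeasurable.integral_prod_right'.measurable, B, fun x => ?_⟩
  have := norm_integral_le_of_norm_le_const (μ := ν) (f := fun y => w (x, y)) (C := B)
    (Eventually.of_forall fun y => hB (x, y))
  simpa using this

end BoundedMeasurable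

theorem pow_four_integral_le {X : Type*} [MeasurableSpace X] (μ : Measure X)
    [IsProbabilityMeasure μ] {u : X → ℝ} (hu : BoundedMeasurable u) :
    (∫ x, u x ∂μ) ^ 4 ≤ ∫ x, u x ^ 4 ∂μ :=
  (Even.convexOn_pow (n := 4) ⟨2, rfl⟩).map_integral_le (by fun_prop) isClosed_univ
    (by simp) (hu.integrable μ) ((hu.pow 4).integrable μ)

/-- The term linear in `b` is kept because it integrates to zero for centred `b`. The parameter `t`
keeps the coefficient of `a ^ 4` close to 1, so that it can be iterated. -/
theorem add_pow_four_le {t : ℝ} (ht : 0 < t) (a b : ℝ) :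
    (a + b) ^ 4 ≤ (1 + 4 / t) * a ^ 4 + 4 * a ^ 3 * b + (4 * t + 3) * b ^ 4 := by
  have h1 : 8 * a ^ 2 * b ^ 2 ≤ 4 / t * a ^ 4 + 4 * t * b ^ 4 := by
    have : 4 / t * a ^ 4 + 4 * t * b ^ 4 - 8 * a ^ 2 * b ^ 2 = 4 / t * (a ^ 2 - t * b ^ 2) ^ 2 := by
      field_simp
      ring
    have h2 : 0 ≤ 4 / t * (a ^ 2 - t * b ^ 2) ^ 2 := by positivity
    linarith
  have h3 : 0 ≤ 2 * b ^ 2 * (a - b) ^ 2 := by positivity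
  nlinarith

theorem sub_pow_four_le (a b : ℝ) : (a - b) ^ 4 ≤ 8 * (a ^ 4 + b ^ 4) := by
  have h1 : (a - b) ^ 2 ≤ 2 * (a ^ 2 + b ^ 2) := by nlinarith [sq_nonneg (a + b)]
  have h2 : ((a - b) ^ 2) ^ 2 ≤ (2 * (a ^ 2 + b ^ 2)) ^ 2 := by gcongr
  nlinarith [sq_nonneg (a ^ 2 - b ^ 2)]

/-- Integrating out one variable: the other variables and the remaining fluctuation contribute
almost additively to the fourth centred moment. -/
theorem fourth_moment_step {X Y : Type*} [MeasurableSpace X] [MeasurableSpace Y] (μ : Measure X)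
    (ν : Measure Y) [IsProbabilityMeasure μ] [IsProbabilityMeasure ν] {w : X × Y → ℝ}
    (hw : BoundedMeasurable w) {t : ℝ} (ht : 0 < t) (c : ℝ) :
    ∫ x, ∫ y, (w (x, y) - c) ^ 4 ∂ν ∂μ ≤
      (1 + 4 / t) * ∫ x, ((∫ y, w (x, y) ∂ν) - c) ^ 4 ∂μ +
        (4 * t + 3) * ∫ x, ∫ y, (w (x, y) - ∫ y', w (x, y') ∂ν) ^ 4 ∂ν ∂μ := by
  have hv := hw.integral_right ν
  set v : X → ℝ := fun x => ∫ y, w (x, y) ∂ν with hvdef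
  have hD : BoundedMeasurable fun p : X × Y => w p - v p.1 := hw.sub (hv.comp measurable_fst)
  have hD4 := (hD.pow 4).integral_right ν
  have hM4 := (hv.sub (BoundedMeasurable.const c)).pow 4
  have hL := ((hw.sub (BoundedMeasurable.const c)).pow 4).integral_right ν
  calc ∫ x, ∫ y, (w (x, y) - c) ^ 4 ∂ν ∂μ
      ≤ ∫ x, ((1 + 4 / t) * (v x - c) ^ 4 +
          (4 * t + 3) * ∫ y, (w (x, y) - v x) ^ 4 ∂ν) ∂μ := by
        refine integral_mono (hL.integrable μ)
          (((BoundedMeasurable.const _).mul hM4).add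
            ((BoundedMeasurable.const _).mul hD4) |>.integrable μ) fun x => ?_
        have hx : BoundedMeasurable fun y => w (x, y) := hw.comp measurable_prodMk_left
        have hDx : BoundedMeasurable fun y => w (x, y) - v x := hx.sub (BoundedMeasurable.const _)
        have hz : ∫ y, (w (x, y) - v x) ∂ν = 0 := by
          rw [integral_sub (hx.integrable ν) (integrable_const _)]
          simp [hvdef]
        have hint : Integrable (fun y => (1 + 4 / t) * (v x - c) ^ 4 +
            4 * (v x - c) ^ 3 * (w (x, y) - v x)) ν :=
          (integrable_const _).add ((hDx.integrable ν).const_mul _)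
        calc ∫ y, (w (x, y) - c) ^ 4 ∂ν
            ≤ ∫ y, ((1 + 4 / t) * (v x - c) ^ 4 + 4 * (v x - c) ^ 3 * (w (x, y) - v x) +
              (4 * t + 3) * (w (x, y) - v x) ^ 4) ∂ν := by
              refine integral_mono (((hx.sub (BoundedMeasurable.const c)).pow 4).integrable ν)
                (hint.add (((hDx.pow 4).integrable ν).const_mul _)) fun y => ?_
              have := add_pow_four_le ht (v x - c) (w (x, y) - v x)
              rwa [sub_add_sub_cancel' (v x) c (w (x, y))] at this
          _ = (1 + 4 / t) * (v x - c) ^ 4 + (4 * t + 3) * ∫ y, (w (x, y) - v x) ^ 4 ∂ν := by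
              rw [integral_add hint (((hDx.pow 4).integrable ν).const_mul _),
                integral_add (integrable_const _) ((hDx.integrable ν).const_mul _),
                integral_const, integral_const_mul, integral_const_mul, hz, probReal_univ, one_smul,
                mul_zero, add_zero]
    _ = _ := by
        rw [integral_add ((hM4.integrable μ).const_mul _) ((hD4.integrable μ).const_mul _),
          integral_const_mul, integral_const_mul]

section Pi

variable {E : Type*} [MeasurableSpace E] (ν : Measure E) [IsProbabilityMeasure ν]

theorem integral_pi_succ {m : ℕ} (u : (Fin (m + 1) → E) → ℝ) :
    ∫ z, u z ∂Measure.pi (fun _ => ν) =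
      ∫ p : E × (Fin m → E), u (Fin.cons p.1 p.2) ∂(ν.prod (Measure.pi fun _ => ν)) := by
  have h := (measurePreserving_piFinSuccAbove (fun _ : Fin (m + 1) => ν) 0).symm
  rw [← h.integral_comp']
  exact integral_congr_ae (.of_forall fun p => congrArg u (Fin.insertNth_zero' p.1 p.2))

theorem measurable_finCons {m : ℕ} :
    Measurable fun p : E × (Fin m → E) => (Fin.cons p.1 p.2 : Fin (m + 1) → E) :=
  measurable_pi_iff.2 fun i => by
    refine Fin.cases ?_ (fun j => ?_) i
    · exact measurable_fst
    · exact (measurable_pi_apply j).comp measurable_snd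

theorem integral_pi_succ' {m : ℕ} {u : (Fin (m + 1) → E) → ℝ} (hu : BoundedMeasurable u) :
    ∫ z, u z ∂Measure.pi (fun _ => ν) =
      ∫ x, ∫ y, u (Fin.cons y x) ∂ν ∂(Measure.pi fun _ : Fin m => ν) := by
  rw [integral_pi_succ, integral_prod_symm _ ((hu.comp measurable_finCons).integrable _)]

/-- If changing one of the `m` independent variables changes a function by a quantity of bounded
fourth moment, then its fourth centred moment is of order `m ^ 2`. -/
theorem fourth_moment_pi_le {C : ℝ} (hC : 0 ≤ C) : ∀ (m : ℕ) {g : (Fin m → E) → ℝ},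
    BoundedMeasurable g →
    (∀ i y y', ∫ x, (g (Function.update x i y) - g (Function.update x i y')) ^ 4
      ∂(Measure.pi fun _ => ν) ≤ C) →
    ∫ x, (g x - ∫ x', g x' ∂(Measure.pi fun _ => ν)) ^ 4 ∂(Measure.pi fun _ => ν) ≤
      20 * C * m ^ 2
  | 0, g, hg, _ => by
    have h : ∀ x, g x - ∫ x', g x' ∂(Measure.pi fun _ => ν) = 0 := fun x => by
      have : g = fun _ => g x := funext fun y => congrArg g (Subsingleton.elim y x)
      rw [this]
      simp
    simp [h]
  | m + 1, g, hg, hdiff => by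
    set π : Measure (Fin m → E) := Measure.pi fun _ => ν with hπ
    let w : (Fin m → E) × E → ℝ := fun p => g (Fin.cons p.2 p.1)
    have hw : BoundedMeasurable w := hg.comp (measurable_finCons.comp measurable_swap)
    have hv := hw.integral_right ν
    have hupd : ∀ (i : Fin m) (y : E), Measurable fun x : Fin m → E => Function.update x i y :=
      fun i y => measurable_update_left
    have hupd' : ∀ (i : Fin (m + 1)) (y : E),
        Measurable fun x : Fin (m + 1) → E => Function.update x i y :=
      fun i y => measurable_update_left
    have hmean : ∫ z, g z ∂(Measure.pi fun _ => ν) = ∫ x, ∫ y, w (x, y) ∂ν ∂π :=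
      integral_pi_succ' ν hg
    -- By Jensen's inequality, averaging over the first variable preserves the bound on the changes
    -- in the others.
    have hrec := fourth_moment_pi_le hC m hv (fun i y y' => by
      have hA : BoundedMeasurable fun z : Fin (m + 1) → E =>
          (g (Function.update z i.succ y) - g (Function.update z i.succ y')) ^ 4 :=
        ((hg.comp (hupd' _ y)).sub (hg.comp (hupd' _ y'))).pow 4
      refine le_trans ?_ (hdiff i.succ y y')
      rw [integral_pi_succ' ν hA]
      refine integral_mono (BoundedMeasurable.integrable
        (((hv.comp (hupd i y)).sub (hv.comp (hupd i y'))).pow 4) _)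
        ((BoundedMeasurable.integral_right (w := fun p : (Fin m → E) × E =>
          (g (Function.update (Fin.cons p.2 p.1) i.succ y) -
            g (Function.update (Fin.cons p.2 p.1) i.succ y')) ^ 4)
          (hA.comp (measurable_finCons.comp measurable_swap)) ν).integrable _) fun x => ?_
      have hy : ∀ y, BoundedMeasurable fun a => w (Function.update x i y, a) := fun y =>
        hw.comp measurable_prodMk_left
      dsimp only
      rw [← integral_sub ((hy y).integrable ν) ((hy y').integrable ν)]
      refine (pow_four_integral_le ν ((hy y).sub (hy y'))).trans_eq ?_
      simp only [w, Fin.cons_update])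
    -- The conditional mean is replaced by an independent copy of the first variable, again by
    -- Jensen. After exchanging the integrals, the hypothesis applies to each pair of values.
    have hDle : ∫ x, ∫ y, (w (x, y) - ∫ y', w (x, y') ∂ν) ^ 4 ∂ν ∂π ≤ C := by
      have hH : BoundedMeasurable fun q : (Fin m → E) × (E × E) =>
          (w (q.1, q.2.1) - w (q.1, q.2.2)) ^ 4 :=
        ((hw.comp (f := fun q : (Fin m → E) × (E × E) => (q.1, q.2.1)) (by fun_prop)).sub
          (hw.comp (f := fun q : (Fin m → E) × (E × E) => (q.1, q.2.2)) (by fun_prop))).pow 4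
      calc ∫ x, ∫ y, (w (x, y) - ∫ y', w (x, y') ∂ν) ^ 4 ∂ν ∂π
          ≤ ∫ x, ∫ p : E × E, (w (x, p.1) - w (x, p.2)) ^ 4 ∂(ν.prod ν) ∂π := by
            refine integral_mono (BoundedMeasurable.integrable
              (BoundedMeasurable.integral_right
                ((hw.sub (hv.comp measurable_fst)).pow 4) ν) _)
              ((hH.integral_right (ν.prod ν)).integrable _) fun x => ?_
            have hx : BoundedMeasurable fun y => w (x, y) := hw.comp measurable_prodMk_left
            have hxx : BoundedMeasurable fun p : E × E => (w (x, p.1) - w (x, p.2)) ^ 4 :=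
              ((hx.comp measurable_fst).sub (hx.comp measurable_snd)).pow 4
            dsimp only
            rw [integral_prod _ (hxx.integrable _)]
            refine integral_mono (BoundedMeasurable.integrable
              ((hx.sub (BoundedMeasurable.const _)).pow 4) _)
              ((hxx.integral_right ν).integrable _) fun y => ?_
            have hs := (BoundedMeasurable.const (w (x, y))).sub hx
            have := pow_four_integral_le ν hs
            rwa [integral_sub (integrable_const _) (hx.integrable ν), integral_const,
              probReal_univ, one_smul] at this
        _ = ∫ p : E × E, ∫ x, (w (x, p.1) - w (x, p.2)) ^ 4 ∂π ∂(ν.prod ν) :=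
            integral_integral_swap (hH.integrable _)
        _ ≤ ∫ _ : E × E, C ∂(ν.prod ν) := by
            refine integral_mono ((BoundedMeasurable.integral_right
              (w := fun q : (E × E) × (Fin m → E) => (w (q.2, q.1.1) - w (q.2, q.1.2)) ^ 4)
              (hH.comp measurable_swap) π).integrable _)
              (integrable_const _) fun p => ?_
            refine le_trans ?_ (hdiff 0 p.1 p.2)
            rw [integral_pi_succ' ν
              (((hg.comp (hupd' 0 p.1)).sub (hg.comp (hupd' 0 p.2))).pow 4)]
            simp [w, hπ]
        _ = C := by simp
    -- With this `t` the old bound is multiplied by `1 + 1 / (m + 1)`, which adds at most `20 * C *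
    -- m`, and the new term is `(16 * m + 19) * C`. Together they fit into the increment `20 * C *
    -- (2 * m + 1)`.
    have ht : (0 : ℝ) < 4 * (m + 1) := by positivity
    have hstep := fourth_moment_step π ν hw ht (∫ z, g z ∂(Measure.pi fun _ => ν))
    rw [integral_pi_succ' ν ((hg.sub (BoundedMeasurable.const _)).pow 4)]
    rw [← hmean] at hrec
    refine hstep.trans ?_
    have hfac : (0 : ℝ) ≤ 1 + 4 / (4 * (m + 1)) := by positivity
    have h1 := mul_le_mul_of_nonneg_left hrec hfac
    have h2 := mul_le_mul_of_nonneg_left hDle (by positivity : (0 : ℝ) ≤ 4 * (4 * (m + 1)) + 3)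
    refine (add_le_add h1 h2).trans ?_
    have h3 : (4 : ℝ) / (4 * (m + 1)) * m ^ 2 ≤ m := by
      rw [div_mul_eq_mul_div, div_le_iff₀ ht]
      nlinarith [Nat.cast_nonneg (α := ℝ) m]
    push_cast
    nlinarith [mul_le_mul_of_nonneg_left h3 hC, mul_nonneg hC (Nat.cast_nonneg (α := ℝ) m)]

end Pi

/-! ### Functionals of random samples -/

open Classical in
/-- The configuration of the points of a sample. -/
def sample {E : Type*} {m : ℕ} (x : Fin m → E) : Configuration E := ⟨Finset.univ.image x⟩

theorem coe_points_sample {E : Type*} {m : ℕ} (x : Fin m → E) :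
    ((sample x).points : Set E) = Set.range x := by
  simp [sample]

theorem sample_mem_voidEvent {E : Type*} {m : ℕ} (x : Fin m → E) (B : Set E) :
    sample x ∈ voidEvent B ↔ ∀ i, x i ∈ Bᶜ := by
  simp [sample, voidEvent]

theorem measurable_sample {E : Type*} [MeasurableSpace E] {m : ℕ} :
    Measurable (sample : (Fin m → E) → Configuration E) :=
  measurable_toConfiguration fun B hB => by
    have : sample ⁻¹' voidEvent B = ⋂ i, (fun x : Fin m → E => x i) ⁻¹' Bᶜ := by
      ext x
      simp [sample_mem_voidEvent]
    rw [this]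
    exact MeasurableSet.iInter fun i => measurable_pi_apply i hB.compl

theorem card_sample_le {E : Type*} {m : ℕ} (x : Fin m → E) : (sample x).points.card ≤ m := by
  classical
  simpa [sample] using Finset.card_image_le (s := Finset.univ) (f := x)

open Classical in
/-- A measurable functional of finite configurations that grows at most exponentially and for which
the effect of an additional point is controlled by the number of points at distance at most `δ`. -/
structure IsLocalFunctional {E : Type*} [MeasurableSpace E] [PseudoMetricSpace E]
    (G : Configuration E → ℝ) (δ : ℝ) : Prop where
  measurable : Measurable G
  abs_le : ∀ S, |G S| ≤ 2 ^ S.points.card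
  abs_insert_sub_le : ∀ (S : Finset E) (y : E),
    |G ⟨insert y S⟩ - G ⟨S⟩| ≤ 2 ^ (S.filter fun x => dist x y ≤ δ).card

section Sample

variable {E : Type*} [MeasurableSpace E] [PseudoMetricSpace E] [OpensMeasurableSpace E]
  (ν : Measure E) [IsProbabilityMeasure ν]

/-- As a product of functions of single coordinates, the power integrates to a product of integrals.
-/
theorem pow_card_filter_eq_prod {m : ℕ} (x : Fin m → E) (T : Finset (Fin m)) (a δ : ℝ) (y : E)
    [DecidablePred fun j => dist (x j) y ≤ δ] :
    a ^ (T.filter fun j => dist (x j) y ≤ δ).card =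
      ∏ j, (fun z => if j ∈ T then 1 + (Metric.closedBall y δ).indicator (fun _ => a - 1) z else 1)
        (x j) := by
  classical
  rw [← Finset.prod_subset (Finset.subset_univ T) (fun j _ hj => by simp [hj]),
    ← Finset.prod_const, Finset.prod_filter]
  refine Finset.prod_congr rfl fun j hj => ?_
  by_cases h : dist (x j) y ≤ δ
  · simp [h, hj]
  · have : x j ∉ Metric.closedBall y δ := h
    simp [h, hj]

theorem boundedMeasurable_pow_degree {m : ℕ} (T : Finset (Fin m)) {a δ : ℝ} (ha : 1 ≤ a) (y : E)
    [∀ x : Fin m → E, DecidablePred fun j => dist (x j) y ≤ δ] :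
    BoundedMeasurable fun x : Fin m → E => a ^ (T.filter fun j => dist (x j) y ≤ δ).card := by
  refine ⟨?_, a ^ T.card, fun x => ?_⟩
  · simp only [pow_card_filter_eq_prod]
    refine Finset.measurable_prod _ fun j _ => ?_
    by_cases hj : j ∈ T
    · simp only [hj, if_true]
      exact measurable_const.add ((measurable_const.indicator
        Metric.isClosed_closedBall.measurableSet).comp (measurable_pi_apply j))
    · simp only [hj, if_false]
      exact measurable_const
  · rw [abs_of_nonneg (by positivity)]
    exact pow_le_pow_right₀ ha (Finset.card_filter_le _ _)

/-- Each point contributes a factor of mean at most `1 + (a - 1) * p`, which is at most `exp ((a -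
1) * p)`. -/
theorem integral_pow_degree_le {m : ℕ} (T : Finset (Fin m)) {a δ p : ℝ} (ha : 1 ≤ a)
    (hp : ∀ z, ν.real (Metric.closedBall z δ) ≤ p) (y : E)
    [∀ x : Fin m → E, DecidablePred fun j => dist (x j) y ≤ δ] :
    ∫ x : Fin m → E, a ^ (T.filter fun j => dist (x j) y ≤ δ).card ∂(Measure.pi fun _ => ν) ≤
      Real.exp ((a - 1) * p * m) := by
  classical
  have hp0 : 0 ≤ p := measureReal_nonneg.trans (hp y)
  simp only [pow_card_filter_eq_prod]
  rw [integral_fintype_prod_eq_prod (fun (j : Fin m) (z : E) =>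
    if j ∈ T then 1 + (Metric.closedBall y δ).indicator (fun _ => a - 1) z else (1 : ℝ))]
  have hexp : Real.exp ((a - 1) * p * m) = ∏ _j : Fin m, Real.exp ((a - 1) * p) := by
    rw [Finset.prod_const, Finset.card_univ, Fintype.card_fin, ← Real.exp_nat_mul]
    congr 1
    ring
  rw [hexp]
  have hind : 0 ≤ fun z => (Metric.closedBall y δ).indicator (fun _ => a - 1) z := fun z =>
    Set.indicator_nonneg (fun _ _ => by linarith) z
  refine Finset.prod_le_prod (fun j _ => integral_nonneg fun z => ?_) fun j _ => ?_
  · have := hind z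
    by_cases hj : j ∈ T
    · simp only [hj, if_true]
      exact add_nonneg zero_le_one this
    · simp [hj]
  · by_cases hj : j ∈ T
    · simp only [hj, if_true]
      rw [integral_add (integrable_const _) ((integrable_const _).indicator
        Metric.isClosed_closedBall.measurableSet),
        integral_indicator Metric.isClosed_closedBall.measurableSet]
      simp only [integral_const, probReal_univ, smul_eq_mul, one_mul, measureReal_restrict_apply_univ]
      have := Real.add_one_le_exp ((a - 1) * p)
      nlinarith [hp y]
    · simp only [hj, if_false, integral_const, probReal_univ, smul_eq_mul, one_mul]
      exact Real.one_le_exp (mul_nonneg (by linarith) hp0)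

variable {G : Configuration E → ℝ} {δ p : ℝ}

theorem IsLocalFunctional.boundedMeasurable_sample (hG : IsLocalFunctional G δ) (m : ℕ) :
    BoundedMeasurable fun x : Fin m → E => G (sample x) :=
  ⟨hG.measurable.comp measurable_sample, 2 ^ m, fun x => (hG.abs_le _).trans
    (pow_le_pow_right₀ one_le_two (card_sample_le x))⟩

open Classical in
theorem IsLocalFunctional.abs_insert_image_sub_le (hG : IsLocalFunctional G δ) {m : ℕ}
    (x : Fin m → E) (T : Finset (Fin m)) (y : E) :
    |G ⟨insert y (T.image x)⟩ - G ⟨T.image x⟩| ≤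
      2 ^ (T.filter fun j => dist (x j) y ≤ δ).card := by
  refine (hG.abs_insert_sub_le _ y).trans (pow_le_pow_right₀ one_le_two ?_)
  rw [Finset.filter_image]
  exact Finset.card_image_le

open Classical in
theorem sample_update {m : ℕ} (x : Fin m → E) (i : Fin m) (y : E) :
    sample (Function.update x i y) = ⟨insert y ((Finset.univ.erase i).image x)⟩ := by
  unfold sample
  congr 1
  rw [← Finset.insert_erase (Finset.mem_univ i), Finset.image_insert, Function.update_self,
    Finset.erase_insert_eq_erase, Finset.erase_idem]
  congr 1
  refine Finset.image_congr fun j hj => ?_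
  exact Function.update_of_ne (Finset.ne_of_mem_erase (Finset.mem_coe.1 hj)) _ _

/-- Two values of the `i`-th point are both compared with the configuration lacking that point. The
fourth power of `2 ^ degree` is `16 ^ degree`, whence the exponent `15 = 16 - 1`; the constant is
`320 = 20 * 8 * 2`. -/
theorem IsLocalFunctional.fourth_moment_le (hG : IsLocalFunctional G δ)
    (hp : ∀ z, ν.real (Metric.closedBall z δ) ≤ p) (m : ℕ) :
    ∫ x : Fin m → E, (G (sample x) - ∫ x' : Fin m → E, G (sample x') ∂(Measure.pi fun _ => ν)) ^ 4
      ∂(Measure.pi fun _ => ν) ≤ 320 * Real.exp (15 * p * m) * m ^ 2 := by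
  classical
  have hb := hG.boundedMeasurable_sample m
  refine (fourth_moment_pi_le ν (C := 16 * Real.exp (15 * p * m)) (by positivity) m hb
    fun i y y' => ?_).trans_eq (by ring)
  have hdeg : ∀ y, BoundedMeasurable fun x : Fin m → E =>
      (16 : ℝ) ^ ((Finset.univ.erase i).filter fun j => dist (x j) y ≤ δ).card := fun y =>
    boundedMeasurable_pow_degree _ (by norm_num) y
  have hint : ∀ y, ∫ x : Fin m → E,
      (16 : ℝ) ^ ((Finset.univ.erase i).filter fun j => dist (x j) y ≤ δ).card
      ∂(Measure.pi fun _ => ν) ≤ Real.exp (15 * p * m) := fun y => by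
    have := integral_pow_degree_le ν (Finset.univ.erase i) (a := 16) (by norm_num) hp y
    norm_num at this ⊢
    exact this
  calc ∫ x, (G (sample (Function.update x i y)) - G (sample (Function.update x i y'))) ^ 4
        ∂(Measure.pi fun _ => ν)
      ≤ ∫ x : Fin m → E,
        8 * ((16 : ℝ) ^ ((Finset.univ.erase i).filter fun j => dist (x j) y ≤ δ).card +
          (16 : ℝ) ^ ((Finset.univ.erase i).filter fun j => dist (x j) y' ≤ δ).card)
        ∂(Measure.pi fun _ => ν) := by
        refine integral_mono (BoundedMeasurable.integrable
          (((hb.comp measurable_update_left).sub (hb.comp measurable_update_left)).pow 4) _)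
          (((BoundedMeasurable.const 8).mul ((hdeg y).add (hdeg y'))).integrable _) fun x => ?_
        have hpow : ∀ y, (G (sample (Function.update x i y)) -
            G ⟨(Finset.univ.erase i).image x⟩) ^ 4 ≤
            (16 : ℝ) ^ ((Finset.univ.erase i).filter fun j => dist (x j) y ≤ δ).card := by
          intro y
          rw [sample_update, ← Even.pow_abs ⟨2, rfl⟩]
          refine (pow_le_pow_left₀ (abs_nonneg _)
            (hG.abs_insert_image_sub_le x (Finset.univ.erase i) y) 4).trans_eq ?_
          rw [← pow_mul, mul_comm, pow_mul]
          norm_num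
        dsimp only
        refine le_trans ?_ (mul_le_mul_of_nonneg_left (add_le_add (hpow y) (hpow y')) (by norm_num))
        have := sub_pow_four_le (G (sample (Function.update x i y)) -
            G ⟨(Finset.univ.erase i).image x⟩) (G (sample (Function.update x i y')) -
            G ⟨(Finset.univ.erase i).image x⟩)
        rwa [sub_sub_sub_cancel_right] at this
    _ ≤ 16 * Real.exp (15 * p * m) := by
        rw [integral_const_mul, integral_add ((hdeg y).integrable _) ((hdeg y').integrable _)]
        linarith [hint y, hint y']

/-- A sample of size `m + 1` is a sample of size `m` with one more independent point, whose expected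
effect is bounded by the case `a = 2` of `integral_pow_degree_le`. -/
theorem IsLocalFunctional.abs_integral_succ_sub_le (hG : IsLocalFunctional G δ)
    (hp : ∀ z, ν.real (Metric.closedBall z δ) ≤ p) (m : ℕ) :
    |(∫ x : Fin (m + 1) → E, G (sample x) ∂(Measure.pi fun _ => ν)) -
      ∫ x : Fin m → E, G (sample x) ∂(Measure.pi fun _ => ν)| ≤ Real.exp (p * m) := by
  classical
  have hb := hG.boundedMeasurable_sample m
  have hb' := (hG.boundedMeasurable_sample (m + 1)).comp (measurable_finCons (E := E) (m := m))
  rw [integral_pi_succ ν, integral_prod _ (hb'.integrable _)]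
  have h1 : ∀ y : E, |(∫ x : Fin m → E, G (sample (Fin.cons y x : Fin (m + 1) → E))
      ∂(Measure.pi fun _ => ν)) - ∫ x : Fin m → E, G (sample x) ∂(Measure.pi fun _ => ν)| ≤
      Real.exp (p * m) := by
    intro y
    rw [← integral_sub ((hb'.comp measurable_prodMk_left).integrable _) (hb.integrable _)]
    refine abs_integral_le_integral_abs.trans ?_
    have hd := boundedMeasurable_pow_degree (E := E) (Finset.univ (α := Fin m)) (a := 2) (δ := δ)
      (by norm_num) y
    refine (integral_mono (((hb'.comp measurable_prodMk_left).sub hb).integrable _).abs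
      (hd.integrable _) fun x => ?_).trans ((integral_pow_degree_le ν Finset.univ (a := 2)
        (by norm_num) hp y).trans_eq (by norm_num))
    have hs : sample (Fin.cons y x : Fin (m + 1) → E) = ⟨insert y (Finset.univ.image x)⟩ := by
      apply Configuration.ext
      ext w
      simp [sample, Fin.exists_fin_succ, eq_comm]
    dsimp only
    rw [hs]
    exact hG.abs_insert_image_sub_le x Finset.univ y
  have hI : BoundedMeasurable fun y : E => ∫ x : Fin m → E,
      G (sample (Fin.cons y x : Fin (m + 1) → E)) ∂(Measure.pi fun _ => ν) :=
    hb'.integral_right _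
  have h2 := norm_integral_le_of_norm_le_const (μ := ν) (C := Real.exp (p * m)) (f := fun y : E =>
    (∫ x : Fin m → E, G (sample (Fin.cons y x : Fin (m + 1) → E)) ∂(Measure.pi fun _ => ν)) -
      ∫ x : Fin m → E, G (sample x) ∂(Measure.pi fun _ => ν)) (Eventually.of_forall h1)
  rw [integral_sub (hI.integrable _) (integrable_const _)] at h2
  simpa using h2

theorem IsLocalFunctional.abs_integral_sub_le (hG : IsLocalFunctional G δ)
    (hp : ∀ z, ν.real (Metric.closedBall z δ) ≤ p) (m n : ℕ) :
    |(∫ x : Fin m → E, G (sample x) ∂(Measure.pi fun _ => ν)) -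
      ∫ x : Fin n → E, G (sample x) ∂(Measure.pi fun _ => ν)| ≤
      |(m : ℝ) - n| * Real.exp (p * (m + n)) := by
  set h : ℕ → ℝ := fun m => ∫ x : Fin m → E, G (sample x) ∂(Measure.pi fun _ => ν) with hdef
  have hstep : ∀ m, |h (m + 1) - h m| ≤ Real.exp (p * m) := hG.abs_integral_succ_sub_le ν hp
  have hp0 : 0 ≤ p := by
    obtain ⟨z⟩ := ν.nonempty_of_neZero
    exact measureReal_nonneg.trans (hp z)
  have key : ∀ n l, |h (n + l) - h n| ≤ l * Real.exp (p * ((n + l : ℕ) : ℝ)) := by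
    intro n l
    induction l with
    | zero => simp
    | succ l ih =>
      have h1 := hstep (n + l)
      have e1 : Real.exp (p * ((n + l : ℕ) : ℝ)) ≤ Real.exp (p * ((n + (l + 1) : ℕ) : ℝ)) := by
        gcongr
        omega
      have h2 := abs_sub_le (h (n + (l + 1))) (h (n + l)) (h n)
      have h3 : (l : ℝ) * Real.exp (p * ((n + l : ℕ) : ℝ)) ≤
          l * Real.exp (p * ((n + (l + 1) : ℕ) : ℝ)) := by gcongr
      push_cast at *
      rw [← add_assoc] at h2 ⊢
      linarith
  have hmono : ∀ a b : ℕ, a ≤ b → Real.exp (p * b) ≤ Real.exp (p * (a + b)) := by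
    intro a b _
    gcongr
    simp
  rcases le_total n m with hnm | hnm
  · obtain ⟨l, rfl⟩ := Nat.exists_eq_add_of_le hnm
    refine (key n l).trans ?_
    have := hmono n (n + l) (by omega)
    push_cast at *
    rw [add_sub_cancel_left, Nat.abs_cast, add_comm ((n : ℝ) + l)]
    gcongr
  · obtain ⟨l, rfl⟩ := Nat.exists_eq_add_of_le hnm
    rw [abs_sub_comm]
    refine (key m l).trans ?_
    have := hmono m (m + l) (by omega)
    push_cast at *
    rw [sub_add_cancel_left, abs_neg, Nat.abs_cast]
    gcongr

end Sample

/-! ### Poisson samples -/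

theorem tsum_poissonMeasure_mul_pow (l : NNReal) {s : ℝ} (hs : 0 ≤ s) :
    ∑' m : ℕ, poissonMeasure l {m} * ENNReal.ofReal (s ^ m) =
      ENNReal.ofReal (Real.exp (l * (s - 1))) := by
  have h := (NormedSpace.expSeries_div_hasSum_exp ((l : ℝ) * s)).mul_left (Real.exp (-l))
  rw [← Real.exp_eq_exp_ℝ] at h
  have hterm : ∀ m : ℕ, poissonMeasure l {m} * ENNReal.ofReal (s ^ m) =
      ENNReal.ofReal (Real.exp (-l) * (((l : ℝ) * s) ^ m / m.factorial)) := fun m => by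
    rw [poissonMeasure_singleton, ← ENNReal.ofReal_mul (by positivity)]
    congr 1
    rw [mul_pow]
    ring
  simp only [hterm]
  rw [← ENNReal.ofReal_tsum_of_nonneg (fun m => by positivity) h.summable, h.tsum_eq,
    ← Real.exp_add]
  congr 2
  ring

theorem tsum_poissonMeasure_mul_exp (l : NNReal) (t : ℝ) :
    ∑' m : ℕ, poissonMeasure l {m} * ENNReal.ofReal (Real.exp (t * m)) =
      ENNReal.ofReal (Real.exp (l * (Real.exp t - 1))) := by
  rw [← tsum_poissonMeasure_mul_pow l (Real.exp_nonneg t)]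
  refine tsum_congr fun m => ?_
  rw [← Real.exp_nat_mul, mul_comm t]

/-- The law of the configuration of the points of a sample of Poisson size. -/
def poissonSample {E : Type*} [MeasurableSpace E] (ν : Measure E) (l : NNReal) :
    Measure (Configuration E) :=
  Measure.sum fun m : ℕ => poissonMeasure l {m} • (Measure.pi fun _ : Fin m => ν).map sample

section PoissonSample

variable {E : Type*} [MeasurableSpace E] (ν : Measure E) [IsProbabilityMeasure ν] (l : NNReal)

theorem lintegral_poissonSample {u : Configuration E → ENNReal} (hu : Measurable u) :
    ∫⁻ S, u S ∂(poissonSample ν l) = ∑' m : ℕ, poissonMeasure l {m} *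
      ∫⁻ x : Fin m → E, u (sample x) ∂(Measure.pi fun _ => ν) := by
  rw [poissonSample, lintegral_sum_measure]
  refine tsum_congr fun m => ?_
  rw [lintegral_smul_measure, lintegral_map hu measurable_sample, smul_eq_mul]

/-- A sample of size `m` avoids `B` with probability `(1 - ν B) ^ m`, so this is the Poisson
generating function at `1 - ν B`. -/
theorem poissonSample_voidEvent {B : Set E} (hB : MeasurableSet B) :
    poissonSample ν l (voidEvent B) = ENNReal.ofReal (Real.exp (-(l * ν.real B))) := by
  rw [← lintegral_indicator_one (measurableSet_voidEvent hB),
    lintegral_poissonSample ν l (measurable_one.indicator (measurableSet_voidEvent hB))]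
  have h : ∀ m : ℕ, ∫⁻ x : Fin m → E, (voidEvent B).indicator 1 (sample x)
      ∂(Measure.pi fun _ => ν) = ENNReal.ofReal ((1 - ν.real B) ^ m) := fun m => by
    have hpre : (fun x : Fin m → E => (voidEvent B).indicator (1 : Configuration E → ENNReal)
        (sample x)) = (Set.univ.pi fun _ => Bᶜ).indicator 1 := by
      funext x
      by_cases hx : sample x ∈ voidEvent B
      · rw [Set.indicator_of_mem hx, Set.indicator_of_mem]
        · rfl
        · exact fun i _ => (sample_mem_voidEvent x B).1 hx i
      · rw [Set.indicator_of_notMem hx, Set.indicator_of_notMem]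
        exact fun h => hx ((sample_mem_voidEvent x B).2 fun i => h i trivial)
    rw [hpre, lintegral_indicator_one (MeasurableSet.univ_pi fun _ => hB.compl), Measure.pi_pi,
      Finset.prod_const, Finset.card_univ, Fintype.card_fin, ENNReal.ofReal_pow
        (by linarith [measureReal_le_one (μ := ν) (s := B)]), ← probReal_compl_eq_one_sub hB,
      ofReal_measureReal]
  simp only [h]
  rw [tsum_poissonMeasure_mul_pow l (by linarith [measureReal_le_one (μ := ν) (s := B)])]
  congr 2
  ring

instance : IsProbabilityMeasure (poissonSample ν l) := by
  refine ⟨?_⟩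
  have : (Set.univ : Set (Configuration E)) = voidEvent ∅ := by
    ext S
    simp [voidEvent]
  rw [this, poissonSample_voidEvent ν l MeasurableSet.empty]
  simp

end PoissonSample

theorem exp_le_one_add_add_sq_mul_exp (t : ℝ) :
    Real.exp t ≤ 1 + t + t ^ 2 * Real.exp |t| := by
  have h := Complex.norm_exp_sub_sum_le_norm_mul_exp (t : ℂ) 2
  have e : Complex.exp (t : ℂ) - ∑ m ∈ Finset.range 2, (t : ℂ) ^ m / m.factorial =
      ((Real.exp t - (1 + t) : ℝ) : ℂ) := by
    simp [Finset.sum_range_succ]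
  rw [e, Complex.norm_real, Complex.norm_real, Real.norm_eq_abs, Real.norm_eq_abs, sq_abs] at h
  linarith [le_abs_self (Real.exp t - (1 + t))]

/-- On the scale `t = O(1 / √n)` the exponent of the Poisson moment generating function is linear up
to a bounded error. -/
theorem mul_exp_sub_one_le {n : ℕ} (hn : 1 ≤ n) {a t : ℝ} (ht : |t| * √n ≤ a) :
    n * (Real.exp t - 1) ≤ n * t + a ^ 2 * Real.exp a := by
  have hn' : (1 : ℝ) ≤ n := by exact_mod_cast hn
  have h1 := exp_le_one_add_add_sq_mul_exp t
  have hs : 1 ≤ √(n : ℝ) := Real.one_le_sqrt.2 hn'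
  have hta : |t| ≤ a := by nlinarith [abs_nonneg t]
  have h2 : n * t ^ 2 ≤ a ^ 2 := by
    have : (|t| * √n) ^ 2 ≤ a ^ 2 := pow_le_pow_left₀ (by positivity) ht 2
    rwa [mul_pow, sq_abs, Real.sq_sqrt (Nat.cast_nonneg n), mul_comm] at this
  have h3 : (n * t ^ 2) * Real.exp |t| ≤ a ^ 2 * Real.exp a := by gcongr
  nlinarith

theorem pow_four_le_exp (u : ℝ) : u ^ 4 ≤ 24 * (Real.exp u + Real.exp (-u)) := by
  have h := Real.pow_div_factorial_le_exp |u| (abs_nonneg u) 4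
  rw [Even.pow_abs ⟨2, rfl⟩] at h
  have h2 : Real.exp |u| ≤ Real.exp u + Real.exp (-u) := by
    rcases abs_choice u with e | e <;> rw [e] <;> linarith [Real.exp_pos u, Real.exp_pos (-u)]
  have h3 : ((Nat.factorial 4 : ℕ) : ℝ) = 24 := by norm_num [Nat.factorial]
  rw [h3] at h
  linarith

/-- Exponentially weighted fourth moments of a Poisson variable of mean `n`. -/
theorem tsum_poissonMeasure_moment_le {a : ℝ} (ha : 0 ≤ a) {n : ℕ} (hn : 1 ≤ n) :
    ∑' m : ℕ, poissonMeasure (n : NNReal) {m} *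
        ENNReal.ofReal (Real.exp (a * m / n) * (m ^ 2 + ((m : ℝ) - n) ^ 4)) ≤
      ENNReal.ofReal (50 * Real.exp ((a + 1) + (a + 2) ^ 2 * Real.exp (a + 2)) * n ^ 2) := by
  have hn' : (1 : ℝ) ≤ n := by exact_mod_cast hn
  have hn0 : (0 : ℝ) < n := by linarith
  have hs : 1 ≤ √(n : ℝ) := Real.one_le_sqrt.2 hn'
  have hs2 : √(n : ℝ) * √(n : ℝ) = n := Real.mul_self_sqrt hn0.le
  set D := Real.exp ((a + 1) + (a + 2) ^ 2 * Real.exp (a + 2)) with hD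
  have hsn : √(n : ℝ) / n ≤ 1 := by
    rw [div_le_one hn0]
    nlinarith
  -- The linear part of the exponent is `b + ε * √n`; centring removes `ε * √n`, which leaves a
  -- bound independent of `n`.
  have hbound : ∀ (b ε : ℝ), 0 ≤ b → b ≤ a + 1 → |ε| ≤ 1 →
      ∑' m : ℕ, poissonMeasure (n : NNReal) {m} *
        ENNReal.ofReal (Real.exp (b * m / n + ε * ((m - n) / √n))) ≤ ENNReal.ofReal D := by
    intro b ε hb hba hε
    have hterm : ∀ m : ℕ, poissonMeasure (n : NNReal) {m} *
        ENNReal.ofReal (Real.exp (b * m / n + ε * ((m - n) / √n))) =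
        poissonMeasure (n : NNReal) {m} * ENNReal.ofReal (Real.exp ((b / n + ε / √n) * m)) *
          ENNReal.ofReal (Real.exp (-(ε * √n))) := fun m => by
      rw [mul_assoc, ← ENNReal.ofReal_mul (Real.exp_nonneg _), ← Real.exp_add]
      congr 3
      have : (n : ℝ) / √n = √n := Real.div_sqrt
      rw [sub_div, this]
      ring
    simp only [hterm]
    rw [ENNReal.tsum_mul_right, tsum_poissonMeasure_mul_exp,
      ← ENNReal.ofReal_mul (Real.exp_nonneg _), ← Real.exp_add]
    refine ENNReal.ofReal_le_ofReal (Real.exp_le_exp.2 ?_)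
    have ht : |b / n + ε / √n| * √n ≤ a + 2 := by
      have h1 := abs_add_le (b / n) (ε / √(n : ℝ))
      have h2 : |b / n| * √n ≤ a + 1 := by
        rw [abs_of_nonneg (by positivity), div_mul_eq_mul_div, mul_div_assoc]
        nlinarith
      have h3 : |ε / √(n : ℝ)| * √n ≤ 1 := by
        rw [abs_div, abs_of_nonneg (Real.sqrt_nonneg _), div_mul_cancel₀ _ (by positivity)]
        exact hε
      nlinarith [Real.sqrt_nonneg (n : ℝ)]
    have h := mul_exp_sub_one_le hn ht
    have h4 : n * (b / n + ε / √n) = b + ε * √n := by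
      field_simp
      linear_combination (-ε) * hs2
    rw [h4] at h
    simp only [NNReal.coe_natCast]
    linarith
  -- Polynomial factors are traded for exponentials of `m / n` and of `±(m - n) / √n`, at the price
  -- `n ^ 2`. The constant 50 is `2 + 24 + 24`.
  have hpt : ∀ m : ℕ, Real.exp (a * m / n) * ((m : ℝ) ^ 2 + ((m : ℝ) - n) ^ 4) ≤
      n ^ 2 * (2 * Real.exp ((a + 1) * m / n + 0 * ((m - n) / √n)) +
        24 * (Real.exp (a * m / n + 1 * ((m - n) / √n)) +
          Real.exp (a * m / n + (-1) * ((m - n) / √n)))) := by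
    intro m
    have h1 : (m : ℝ) ^ 2 ≤ n ^ 2 * (2 * Real.exp (m / n)) := by
      have := Real.pow_div_factorial_le_exp ((m : ℝ) / n) (by positivity) 2
      have h3 : ((Nat.factorial 2 : ℕ) : ℝ) = 2 := by norm_num [Nat.factorial]
      rw [h3, div_pow, div_div, div_le_iff₀ (by positivity)] at this
      linarith
    have h2 : ((m : ℝ) - n) ^ 4 ≤ n ^ 2 * (24 * (Real.exp ((m - n) / √n) +
        Real.exp (-((m - n) / √n)))) := by
      have := pow_four_le_exp (((m : ℝ) - n) / √n)
      have h3 : √(n : ℝ) ^ 4 = n ^ 2 := by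
        rw [show (4 : ℕ) = 2 * 2 from rfl, pow_mul, Real.sq_sqrt hn0.le]
      rw [div_pow, h3, div_le_iff₀ (by positivity)] at this
      linarith
    have e1 : Real.exp ((a + 1) * m / n + 0 * ((m - n) / √n)) =
        Real.exp (a * m / n) * Real.exp (m / n) := by
      rw [← Real.exp_add]
      congr 1
      ring
    have e2 : ∀ ε : ℝ, Real.exp (a * m / n + ε * ((m - n) / √n)) =
        Real.exp (a * m / n) * Real.exp (ε * ((m - n) / √n)) := fun ε => Real.exp_add _ _
    rw [e1, e2, e2, one_mul, neg_one_mul]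
    have := mul_le_mul_of_nonneg_left (add_le_add h1 h2) (Real.exp_nonneg (a * m / n))
    refine this.trans_eq ?_
    ring
  calc _ ≤ ∑' m : ℕ, ENNReal.ofReal (n ^ 2) * (ENNReal.ofReal 2 *
        (poissonMeasure (n : NNReal) {m} *
          ENNReal.ofReal (Real.exp ((a + 1) * m / n + 0 * ((m - n) / √n)))) + ENNReal.ofReal 24 *
        (poissonMeasure (n : NNReal) {m} *
          ENNReal.ofReal (Real.exp (a * m / n + 1 * ((m - n) / √n))) +
        poissonMeasure (n : NNReal) {m} *
          ENNReal.ofReal (Real.exp (a * m / n + (-1) * ((m - n) / √n))))) := by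
        refine ENNReal.tsum_le_tsum fun m => ?_
        refine (mul_le_mul_right (ENNReal.ofReal_le_ofReal (hpt m)) _).trans_eq ?_
        rw [ENNReal.ofReal_mul (by positivity), ENNReal.ofReal_add (by positivity) (by positivity),
          ENNReal.ofReal_mul (by positivity), ENNReal.ofReal_mul (by positivity),
          ENNReal.ofReal_add (by positivity) (by positivity)]
        ring
    _ ≤ ENNReal.ofReal (n ^ 2) * (ENNReal.ofReal 2 * ENNReal.ofReal D + ENNReal.ofReal 24 *
        (ENNReal.ofReal D + ENNReal.ofReal D)) := by
        rw [ENNReal.tsum_mul_left, ENNReal.tsum_add, ENNReal.tsum_mul_left, ENNReal.tsum_mul_left,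
          ENNReal.tsum_add]
        gcongr
        · exact hbound (a + 1) 0 (by linarith) le_rfl (by simp)
        · exact hbound a 1 ha (by linarith) (by simp)
        · exact hbound a (-1) ha (by linarith) (by simp)
    _ = _ := by
        have hD0 : 0 ≤ D := Real.exp_nonneg _
        rw [← ENNReal.ofReal_add hD0 hD0, ← ENNReal.ofReal_mul (by norm_num),
          ← ENNReal.ofReal_mul (by norm_num), ← ENNReal.ofReal_add (by positivity) (by positivity),
          ← ENNReal.ofReal_mul (by positivity)]
        congr 1
        ring

section PoissonMoment

variable {E : Type*} [MeasurableSpace E] [PseudoMetricSpace E] [OpensMeasurableSpace E]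
  (ν : Measure E) [IsProbabilityMeasure ν] {G : Configuration E → ℝ} {δ p : ℝ}

theorem IsLocalFunctional.integrable_poissonSample (hG : IsLocalFunctional G δ) (l : NNReal) :
    Integrable G (poissonSample ν l) := by
  refine ⟨hG.measurable.aestronglyMeasurable, ?_⟩
  rw [HasFiniteIntegral, lintegral_poissonSample ν l hG.measurable.enorm]
  refine lt_of_le_of_lt (ENNReal.tsum_le_tsum (g := fun m : ℕ =>
    poissonMeasure l {m} * ENNReal.ofReal (2 ^ m)) fun m => ?_) ?_
  · refine mul_le_mul_right ?_ _
    calc _ ≤ ∫⁻ _ : Fin m → E, ENNReal.ofReal (2 ^ m) ∂(Measure.pi fun _ => ν) := by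
          refine lintegral_mono fun x => ?_
          rw [Real.enorm_eq_ofReal_abs]
          exact ENNReal.ofReal_le_ofReal ((hG.abs_le _).trans
            (pow_le_pow_right₀ one_le_two (card_sample_le x)))
      _ = _ := by simp
  · rw [tsum_poissonMeasure_mul_pow l zero_le_two]
    exact ENNReal.ofReal_lt_top

/-- The constant of the fourth moment bound for Poisson samples. -/
def poissonConstant (κ : ℝ) : ℝ :=
  2560 * Real.exp (4 * κ) *
    (50 * Real.exp ((15 * κ + 1) + (15 * κ + 2) ^ 2 * Real.exp (15 * κ + 2)))

/-- The centring is at the mean `h n` of a sample of size exactly `n`. Given size `m`, the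
fluctuation about `h m` and the difference `h n - h m` are bounded separately, and the bounds are
averaged over the Poisson size. -/
theorem IsLocalFunctional.lintegral_poissonSample_le (hG : IsLocalFunctional G δ)
    (hp : ∀ z, ν.real (Metric.closedBall z δ) ≤ p) {κ : ℝ} (hκ : 0 ≤ κ) {n : ℕ} (hn : 1 ≤ n)
    (hpn : n * p ≤ κ) :
    ∫⁻ S, ENNReal.ofReal ((G S - ∫ x : Fin n → E, G (sample x) ∂(Measure.pi fun _ => ν)) ^ 4)
      ∂(poissonSample ν n) ≤ ENNReal.ofReal (poissonConstant κ * n ^ 2) := by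
  have hn0 : (0 : ℝ) < n := by exact_mod_cast hn
  set h : ℕ → ℝ := fun m => ∫ x : Fin m → E, G (sample x) ∂(Measure.pi fun _ => ν) with hdef
  change ∫⁻ S, ENNReal.ofReal ((G S - h n) ^ 4) ∂_ ≤ _
  rw [lintegral_poissonSample ν n ((hG.measurable.sub_const _).pow_const 4).ennreal_ofReal]
  have hpκ : ∀ m : ℕ, p * m ≤ κ * m / n := fun m => by
    rw [le_div_iff₀ hn0]
    nlinarith [Nat.cast_nonneg (α := ℝ) m]
  have hm : ∀ m : ℕ, ∫⁻ x : Fin m → E, ENNReal.ofReal ((G (sample x) - h n) ^ 4)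
      ∂(Measure.pi fun _ => ν) ≤ ENNReal.ofReal (2560 * Real.exp (4 * κ)) *
        ENNReal.ofReal (Real.exp (15 * κ * m / n) * (m ^ 2 + ((m : ℝ) - n) ^ 4)) := by
    intro m
    have hb := hG.boundedMeasurable_sample m
    have hb4 := (hb.sub (BoundedMeasurable.const (h m))).pow 4
    rw [← ofReal_integral_eq_lintegral_ofReal
      (((hb.sub (BoundedMeasurable.const (h n))).pow 4).integrable _)
      (Eventually.of_forall fun x => Even.pow_nonneg ⟨2, rfl⟩ _),
      ← ENNReal.ofReal_mul (by positivity)]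
    refine ENNReal.ofReal_le_ofReal ?_
    have h1 := hG.fourth_moment_le ν hp m
    have h2 := hG.abs_integral_sub_le ν hp n m
    have hE : Real.exp (15 * p * m) ≤ Real.exp (15 * κ * m / n) := by
      refine Real.exp_le_exp.2 ?_
      have := hpκ m
      rw [mul_assoc, mul_assoc, mul_div_assoc]
      linarith
    have h3 : (h n - h m) ^ 4 ≤
        ((m : ℝ) - n) ^ 4 * (Real.exp (4 * κ) * Real.exp (15 * κ * m / n)) := by
      rw [← Even.pow_abs ⟨2, rfl⟩]
      refine (pow_le_pow_left₀ (abs_nonneg _) h2 4).trans ?_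
      rw [mul_pow, Even.pow_abs ⟨2, rfl⟩, ← Real.exp_nat_mul, ← Real.exp_add,
        show ((n : ℝ) - m) ^ 4 = ((m : ℝ) - n) ^ 4 by ring]
      gcongr
      have h4 := hpκ m
      have h5 : 0 ≤ κ * m / n := by positivity
      have h6 : 15 * κ * m / n = 15 * (κ * m / n) := by ring
      push_cast
      rw [h6]
      nlinarith
    have h0 : (1 : ℝ) ≤ Real.exp (4 * κ) := Real.one_le_exp (by linarith)
    calc ∫ x : Fin m → E, (G (sample x) - h n) ^ 4 ∂(Measure.pi fun _ => ν)
        ≤ ∫ x : Fin m → E, 8 * ((G (sample x) - h m) ^ 4 + (h n - h m) ^ 4)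
            ∂(Measure.pi fun _ => ν) := by
          refine integral_mono (((hb.sub (BoundedMeasurable.const (h n))).pow 4).integrable _)
            (((BoundedMeasurable.const 8).mul (hb4.add (BoundedMeasurable.const _))).integrable _)
            fun x => ?_
          have := sub_pow_four_le (G (sample x) - h m) (h n - h m)
          rwa [sub_sub_sub_cancel_right] at this
      _ = 8 * ((∫ x : Fin m → E, (G (sample x) - h m) ^ 4 ∂(Measure.pi fun _ => ν)) +
            (h n - h m) ^ 4) := by
          rw [integral_const_mul, integral_add (hb4.integrable _) (integrable_const _)]
          simp
      _ ≤ 8 * (320 * (Real.exp (4 * κ) * Real.exp (15 * κ * m / n)) * m ^ 2 +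
            ((m : ℝ) - n) ^ 4 * (Real.exp (4 * κ) * Real.exp (15 * κ * m / n))) := by
          gcongr
          refine h1.trans ?_
          gcongr
          refine hE.trans ?_
          nlinarith [Real.exp_pos (15 * κ * m / n)]
      _ ≤ _ := by
          have : 0 ≤ ((m : ℝ) - n) ^ 4 * (Real.exp (4 * κ) * Real.exp (15 * κ * m / n)) := by
            have : 0 ≤ ((m : ℝ) - n) ^ 4 := Even.pow_nonneg ⟨2, rfl⟩ _
            positivity
          nlinarith
  calc _ ≤ ∑' m : ℕ, ENNReal.ofReal (2560 * Real.exp (4 * κ)) *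
        (poissonMeasure (n : NNReal) {m} *
          ENNReal.ofReal (Real.exp (15 * κ * m / n) * (m ^ 2 + ((m : ℝ) - n) ^ 4))) := by
        refine ENNReal.tsum_le_tsum fun m => (mul_le_mul_right (hm m) _).trans_eq ?_
        ring
    _ ≤ _ := by
        rw [ENNReal.tsum_mul_left]
        refine (mul_le_mul_right
          (tsum_poissonMeasure_moment_le (a := 15 * κ) (by positivity) hn) _).trans_eq ?_
        rw [← ENNReal.ofReal_mul (by positivity), poissonConstant]
        congr 1
        ring

end PoissonMoment

/-- The range is `2 * r` because closed balls of radius `r` can only meet if their centres are that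
close. -/
theorem isLocalFunctional_cechBetti (F : Type*) [Field F] {d : ℕ} (k : ℕ) (r : ℝ) :
    IsLocalFunctional (fun S : Configuration (EuclideanSpace ℝ (Fin d)) =>
      (cechBetti F k (S.points : Set (EuclideanSpace ℝ (Fin d))) r : ℝ)) (2 * r) := by
  let := lexOrder d
  refine ⟨measurable_bettiNumber_cechComplex F k r, fun S => ?_, fun S y => ?_⟩
  · rw [Nat.abs_cast]
    exact_mod_cast bettiNumber_cechComplex_le F k S.points r
  · have h := abs_bettiNumber_insert_sub_le F k S y r
    simp only [cechBetti, Finset.coe_insert]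
    convert! (Int.cast_le (R := ℝ)).2 h using 1
    · push_cast
      rfl
    · push_cast
      congr!

/-! ### Poisson processes and samples -/

section PointProcess

variable {Ω E : Type*} [MeasurableSpace Ω] [NormedAddCommGroup E] [MeasurableSpace E]
  [BorelSpace E] {Φ : Ω → Set E} {P : Measure Ω} [IsProbabilityMeasure P]

/-- The configuration of the points of a point process in a bounded set. -/
def IsPointProcess.restrict (hΦ : IsPointProcess Φ) {K : Set E} (hK : Bornology.IsBounded K)
    (ω : Ω) : Configuration E := ⟨(hΦ.finite_inter ω K hK).toFinset⟩

theorem IsPointProcess.coe_points_restrict (hΦ : IsPointProcess Φ) {K : Set E}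
    (hK : Bornology.IsBounded K) (ω : Ω) :
    ((hΦ.restrict hK ω).points : Set E) = Φ ω ∩ K := by
  simp [IsPointProcess.restrict]

theorem IsPointProcess.restrict_mem_voidEvent (hΦ : IsPointProcess Φ) {K : Set E}
    (hK : Bornology.IsBounded K) (B : Set E) :
    hΦ.restrict hK ⁻¹' voidEvent B = {ω | (Φ ω ∩ (K ∩ B)).ncard = 0} := by
  ext ω
  have hfin : (Φ ω ∩ (K ∩ B)).Finite := hΦ.finite_inter ω _ (hK.subset Set.inter_subset_left)
  rw [Set.mem_ofPred_eq, Set.ncard_eq_zero hfin]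
  simp only [IsPointProcess.restrict, Set.mem_preimage, voidEvent, Set.mem_ofPred_eq,
    Set.Finite.mem_toFinset, Set.eq_empty_iff_forall_notMem, Set.mem_inter_iff]
  exact ⟨fun h x hx => h x ⟨hx.1, hx.2.1⟩ hx.2.2, fun h x hx hB => h x ⟨hx.1, hx.2, hB⟩⟩

theorem IsPointProcess.measurable_restrict (hΦ : IsPointProcess Φ) {K : Set E}
    (hK : Bornology.IsBounded K) (hKm : MeasurableSet K) : Measurable (hΦ.restrict hK) :=
  measurable_toConfiguration fun B hB => by
    rw [hΦ.restrict_mem_voidEvent hK B]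
    exact (hΦ.measurable_count _ (hK.subset Set.inter_subset_left) (hKm.inter hB))
      (measurableSet_singleton 0)

theorem IsPoissonProcess.measure_count_eq_zero {μ : Measure E} (hΦ : IsPoissonProcess Φ μ P)
    {B : Set E} (hB : Bornology.IsBounded B) (hBm : MeasurableSet B) :
    P {ω | (Φ ω ∩ B).ncard = 0} = ENNReal.ofReal (Real.exp (-(μ B).toReal)) := by
  have h := (hΦ.hasLaw_count B hB hBm).measure_eq (p := fun j => j = 0) (measurableSet_singleton 0)
  rw [h]
  exact (poissonMeasure_singleton _ 0).trans
    (by simp [ENNReal.coe_toNNReal_eq_toReal])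

/-- The points of a Poisson process of finite intensity `l • ν` are a sample of Poisson size. -/
theorem IsPoissonProcess.map_restrict {ν : Measure E} [IsProbabilityMeasure ν] {l : NNReal}
    (hΦ : IsPoissonProcess Φ (l • ν) P) {K : Set E} (hK : Bornology.IsBounded K)
    (hKm : MeasurableSet K) (hνK : ν Kᶜ = 0) :
    P.map (hΦ.toIsPointProcess.restrict hK) = poissonSample ν l := by
  have hm := hΦ.toIsPointProcess.measurable_restrict hK hKm
  have := Measure.isProbabilityMeasure_map (μ := P) hm.aemeasurable
  refine configuration_measure_ext fun B hB => ?_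
  rw [Measure.map_apply hm (measurableSet_voidEvent hB),
    hΦ.toIsPointProcess.restrict_mem_voidEvent hK B,
    hΦ.measure_count_eq_zero (hK.subset Set.inter_subset_left) (hKm.inter hB),
    poissonSample_voidEvent ν l hB]
  have hBK : ν (K ∩ B) = ν B := by
    rw [Set.inter_comm]
    exact measure_inter_conull hνK
  rw [Measure.smul_apply, hBK, ENNReal.toReal_smul, NNReal.smul_def, smul_eq_mul, measureReal_def]

/-- Counts are controlled in bounded sets only, so the complement of `K` is exhausted by its
intersections with balls. -/
theorem IsPoissonProcess.ae_subset {μ : Measure E} (hΦ : IsPoissonProcess Φ μ P) {K : Set E}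
    (hKm : MeasurableSet K) (hμK : μ Kᶜ = 0) : ∀ᵐ ω ∂P, Φ ω ⊆ K := by
  have h : ∀ N : ℕ, ∀ᵐ ω ∂P, (Φ ω ∩ (Metric.ball 0 N ∩ Kᶜ)).ncard = 0 := fun N => by
    have hb : Bornology.IsBounded (Metric.ball (0 : E) N ∩ Kᶜ) :=
      Metric.isBounded_ball.subset Set.inter_subset_left
    have hbm : MeasurableSet (Metric.ball (0 : E) N ∩ Kᶜ) :=
      Metric.isOpen_ball.measurableSet.inter hKm.compl
    have h1 := hΦ.measure_count_eq_zero hb hbm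
    rw [measure_mono_null Set.inter_subset_right hμK] at h1
    have hms : MeasurableSet {ω | (Φ ω ∩ (Metric.ball 0 N ∩ Kᶜ)).ncard = 0} :=
      (hΦ.measurable_count _ hb hbm) (measurableSet_singleton 0)
    exact (prob_compl_eq_zero_iff hms).2 (by simpa using h1)
  filter_upwards [ae_all_iff.2 h] with ω hω x hx
  by_contra hxK
  obtain ⟨N, hN⟩ := exists_nat_gt ‖x‖
  -- Local finiteness is needed here, as `Set.ncard` also vanishes on infinite sets.
  have hfin : (Φ ω ∩ (Metric.ball 0 N ∩ Kᶜ)).Finite :=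
    hΦ.finite_inter ω _ (Metric.isBounded_ball.subset Set.inter_subset_left)
  have := (Set.ncard_eq_zero hfin).1 (hω N)
  exact Set.notMem_empty x (this ▸ ⟨hx, mem_ball_zero_iff.2 hN, hxK⟩)

end PointProcess

/-! ### Almost sure convergence from fourth moments -/

/-- The sum over `n` of the fourth powers has finite expectation, so it is almost surely finite and
its terms tend to zero. The joint law of the variables plays no role. -/
theorem ae_tendsto_zero_of_fourth_moment {Ω : Type*} [MeasurableSpace Ω] {P : Measure Ω}
    {Y : ℕ → Ω → ℝ} (hY : ∀ n, AEMeasurable (Y n) P) (C : ℝ)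
    (h : ∀ n, 1 ≤ n → ∫⁻ ω, ENNReal.ofReal (Y n ω ^ 4) ∂P ≤ ENNReal.ofReal (C * n ^ 2)) :
    ∀ᵐ ω ∂P, Tendsto (fun n : ℕ => (n : ℝ)⁻¹ * Y n ω) atTop (𝓝 0) := by
  have hmeas : ∀ n : ℕ, AEMeasurable (fun ω => ENNReal.ofReal (((n : ℝ)⁻¹ * Y n ω) ^ 4)) P :=
    fun n => (((hY n).const_mul _).pow_const 4).ennreal_ofReal
  have hterm : ∀ n : ℕ, ∫⁻ ω, ENNReal.ofReal (((n : ℝ)⁻¹ * Y n ω) ^ 4) ∂P ≤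
      ENNReal.ofReal (|C| * (1 / (n : ℝ) ^ 2)) := by
    intro n
    -- At `n = 0` the term vanishes because the inverse of zero is zero.
    rcases Nat.eq_zero_or_pos n with rfl | hn
    · simp
    · have hn0 : (0 : ℝ) < n := by exact_mod_cast hn
      have e : ∀ ω, ENNReal.ofReal (((n : ℝ)⁻¹ * Y n ω) ^ 4) =
          ENNReal.ofReal ((n : ℝ)⁻¹ ^ 4) * ENNReal.ofReal (Y n ω ^ 4) := fun ω => by
        rw [mul_pow, ENNReal.ofReal_mul (by positivity)]
      simp only [e]
      rw [lintegral_const_mul' _ _ ENNReal.ofReal_ne_top]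
      refine (mul_le_mul_right (h n hn) _).trans ?_
      rw [← ENNReal.ofReal_mul (by positivity)]
      refine ENNReal.ofReal_le_ofReal ?_
      have : (n : ℝ)⁻¹ ^ 4 * (C * n ^ 2) = C * (1 / (n : ℝ) ^ 2) := by field_simp
      rw [this]
      gcongr
      exact le_abs_self C
  have hsum : ∫⁻ ω, ∑' n : ℕ, ENNReal.ofReal (((n : ℝ)⁻¹ * Y n ω) ^ 4) ∂P ≠ ⊤ := by
    rw [lintegral_tsum hmeas]
    refine ne_top_of_le_ne_top ?_ (ENNReal.tsum_le_tsum hterm)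
    rw [← ENNReal.ofReal_tsum_of_nonneg (fun n => by positivity)
      ((Real.summable_one_div_nat_pow.2 one_lt_two).mul_left _)]
    exact ENNReal.ofReal_ne_top
  filter_upwards [ae_lt_top' (AEMeasurable.tsum hmeas) hsum] with ω hω
  have h1 := ENNReal.tendsto_atTop_zero_of_tsum_ne_top hω.ne
  have h2 : Tendsto (fun n : ℕ => ((n : ℝ)⁻¹ * Y n ω) ^ 4) atTop (𝓝 0) := by
    have := (ENNReal.tendsto_toReal ENNReal.zero_ne_top).comp h1
    refine this.congr fun n => ?_
    simp only [Function.comp_apply]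
    exact ENNReal.toReal_ofReal (Even.pow_nonneg ⟨2, rfl⟩ _)
  have h3 := (Real.continuous_sqrt.comp Real.continuous_sqrt).continuousAt.tendsto.comp h2
  rw [tendsto_zero_iff_abs_tendsto_zero]
  refine (h3.congr fun n => ?_).trans_eq (by simp)
  simp only [Function.comp_apply]
  rw [show (4 : ℕ) = 2 * 2 from rfl, pow_mul, Real.sqrt_sq (sq_nonneg _), Real.sqrt_sq_eq_abs]

/-- The fourth centred moment is controlled by the fourth moment about any point. -/
theorem lintegral_sub_integral_pow_four_le {Ω : Type*} [MeasurableSpace Ω] {P : Measure Ω}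
    [IsProbabilityMeasure P] {Y : Ω → ℝ} (hY : Integrable Y P) {c M : ℝ} (hM : 0 ≤ M)
    (h : ∫⁻ ω, ENNReal.ofReal ((Y ω - c) ^ 4) ∂P ≤ ENNReal.ofReal M) :
    ∫⁻ ω, ENNReal.ofReal ((Y ω - ∫ ω', Y ω' ∂P) ^ 4) ∂P ≤ ENNReal.ofReal (16 * M) := by
  have hYc : Integrable (fun ω => Y ω - c) P := hY.sub (integrable_const c)
  have hnn : ∀ a : ℝ, 0 ≤ a ^ 4 := fun a => Even.pow_nonneg ⟨2, rfl⟩ a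
  have h4 : Integrable (fun ω => (Y ω - c) ^ 4) P := by
    refine ⟨hYc.aestronglyMeasurable.pow 4, ?_⟩
    rw [hasFiniteIntegral_iff_ofReal (Eventually.of_forall fun ω => hnn _)]
    exact h.trans_lt ENNReal.ofReal_lt_top
  have hI : ∫ ω, (Y ω - c) ^ 4 ∂P ≤ M := by
    rw [← ofReal_integral_eq_lintegral_ofReal h4 (Eventually.of_forall fun ω => hnn _)] at h
    exact (ENNReal.ofReal_le_ofReal_iff hM).1 h
  have hJ : ((∫ ω, Y ω ∂P) - c) ^ 4 ≤ M := by
    have := (Even.convexOn_pow (𝕜 := ℝ) (n := 4) ⟨2, rfl⟩).map_integral_le (μ := P)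
      (f := fun ω => Y ω - c) (by fun_prop) isClosed_univ (by simp) hYc h4
    rw [integral_sub hY (integrable_const c)] at this
    simp only [integral_const, probReal_univ, one_smul] at this
    exact this.trans hI
  calc ∫⁻ ω, ENNReal.ofReal ((Y ω - ∫ ω', Y ω' ∂P) ^ 4) ∂P
      ≤ ∫⁻ ω, ENNReal.ofReal (8 * ((Y ω - c) ^ 4 + M)) ∂P := by
        refine lintegral_mono fun ω => ENNReal.ofReal_le_ofReal ?_
        have := sub_pow_four_le (Y ω - c) ((∫ ω, Y ω ∂P) - c)
        rw [sub_sub_sub_cancel_right] at this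
        linarith
    _ = ENNReal.ofReal (∫ ω, 8 * ((Y ω - c) ^ 4 + M) ∂P) :=
        (ofReal_integral_eq_lintegral_ofReal ((h4.add (integrable_const M)).const_mul 8)
          (Eventually.of_forall fun ω =>
            mul_nonneg (by norm_num) (add_nonneg (hnn _) hM))).symm
    _ ≤ _ := by
        refine ENNReal.ofReal_le_ofReal ?_
        rw [integral_const_mul, integral_add h4 (integrable_const M)]
        simp only [integral_const, probReal_univ, smul_eq_mul, one_mul]
        linarith

/-! ### Admissible densities -/

namespace IsAdmissibleDensity

variable {d : ℕ} {f : EuclideanSpace ℝ (Fin d) → ℝ} (hf : IsAdmissibleDensity f)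

include hf

theorem isProbabilityMeasure :
    IsProbabilityMeasure (volume.withDensity fun x => ENNReal.ofReal (f x)) := by
  have hint : Integrable f := by
    by_contra h
    have := hf.integral_eq_one
    rw [integral_undef h] at this
    exact zero_ne_one this
  refine ⟨?_⟩
  rw [withDensity_apply _ MeasurableSet.univ, Measure.restrict_univ,
    ← ofReal_integral_eq_lintegral_ofReal hint (Eventually.of_forall hf.nonneg),
    hf.integral_eq_one, ENNReal.ofReal_one]

theorem measure_compl_support :
    (volume.withDensity fun x => ENNReal.ofReal (f x)) (tsupport f)ᶜ = 0 := by
  rw [withDensity_apply _ (isClosed_tsupport f).measurableSet.compl]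
  refine (setLIntegral_congr_fun (isClosed_tsupport f).measurableSet.compl
    fun x hx => ?_).trans lintegral_zero
  rw [image_eq_zero_of_notMem_tsupport hx, ENNReal.ofReal_zero]

theorem withDensity_mul (n : ℕ) :
    (volume.withDensity fun x => ENNReal.ofReal ((n : ℝ) * f x)) =
      (n : NNReal) • volume.withDensity fun x => ENNReal.ofReal (f x) := by
  have : (fun x => ENNReal.ofReal ((n : ℝ) * f x)) =
      (n : ENNReal) • fun x => ENNReal.ofReal (f x) := by
    funext x
    rw [ENNReal.ofReal_mul (Nat.cast_nonneg n), ENNReal.ofReal_natCast]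
    rfl
  rw [this, withDensity_smul _ hf.measurable.ennreal_ofReal]
  ext s
  simp [ENNReal.smul_def]

/-- The mass of a ball is at most of the order of its volume. -/
theorem exists_measureReal_closedBall_le : ∃ C : ℝ, 0 ≤ C ∧ ∀ s, 0 < s → ∀ z,
    (volume.withDensity fun x => ENNReal.ofReal (f x)).real (Metric.closedBall z (2 * s)) ≤
      C * s ^ d := by
  obtain ⟨C, hC⟩ := hf.bounded_above
  have hC0 : 0 ≤ C := (hf.nonneg 0).trans (hC 0)
  set v := volume.real (Metric.ball (0 : EuclideanSpace ℝ (Fin d)) 1)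
  refine ⟨C * 2 ^ d * v, by positivity, fun s hs z => ?_⟩
  rw [measureReal_def, withDensity_apply _ Metric.isClosed_closedBall.measurableSet]
  have h1 : ∫⁻ x in Metric.closedBall z (2 * s), ENNReal.ofReal (f x) ≤
      ENNReal.ofReal C * volume (Metric.closedBall z (2 * s)) := by
    rw [← setLIntegral_const]
    exact lintegral_mono fun x => ENNReal.ofReal_le_ofReal (hC x)
  have h2 : volume (Metric.closedBall z (2 * s)) = ENNReal.ofReal ((2 * s) ^ d * v) := by
    rw [Measure.addHaar_closedBall _ _ (by positivity), finrank_euclideanSpace, Fintype.card_fin,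
      ENNReal.ofReal_mul (by positivity), ofReal_measureReal (Metric.isBounded_ball.measure_lt_top.ne)]
  rw [h2, ← ENNReal.ofReal_mul hC0] at h1
  refine (ENNReal.toReal_mono ENNReal.ofReal_ne_top h1).trans_eq ?_
  rw [ENNReal.toReal_ofReal (by positivity)]
  ring

end IsAdmissibleDensity

end CechBetti

end

/-! ### The strong laws for Poisson and binomial processes. -/

theorem mainTheorem3 {d : ℕ} (F : Type*) [Field F]
    (f : EuclideanSpace ℝ (Fin d) → ℝ) (hf : CechBetti.IsAdmissibleDensity f)
    (r : ℕ → ℝ) (hr_pos : ∀ n, 0 < r n) (ρ : ℝ) (hρ : 0 < ρ)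
    (hr : Tendsto (fun n : ℕ => (n : ℝ) * r n ^ d) atTop (𝓝 ρ))
    (k : ℕ) (hk_one : 1 ≤ k) (hk : k ≤ d - 1)
    {Ω : Type*} [MeasurableSpace Ω] (P : Measure Ω) [IsProbabilityMeasure P] :
    (∀ Φ : ℕ → Ω → Set (EuclideanSpace ℝ (Fin d)),
      (∀ n : ℕ, CechBetti.IsPoissonProcess (Φ n)
        (volume.withDensity fun x => ENNReal.ofReal ((n : ℝ) * f x)) P) →
      (∀ n : ℕ, Integrable (fun ω => (CechBetti.cechBetti F k (Φ n ω) (r n) : ℝ)) P) ∧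
      ∀ᵐ ω ∂P, Tendsto
        (fun n : ℕ => (n : ℝ)⁻¹ * ((CechBetti.cechBetti F k (Φ n ω) (r n) : ℝ) -
          ∫ ω', (CechBetti.cechBetti F k (Φ n ω') (r n) : ℝ) ∂P))
        atTop (𝓝 0)) ∧
    (∀ X : (n : ℕ) → Fin n → Ω → EuclideanSpace ℝ (Fin d),
      (∀ n : ℕ, CechBetti.IsIIDSample (X n)
        (volume.withDensity fun x => ENNReal.ofReal (f x)) P) →
      (∀ n : ℕ, Integrable
        (fun ω => (CechBetti.cechBetti F k (CechBetti.samplePoints (X n) ω) (r n) : ℝ)) P) ∧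
      ∀ᵐ ω ∂P, Tendsto
        (fun n : ℕ => (n : ℝ)⁻¹ *
          ((CechBetti.cechBetti F k (CechBetti.samplePoints (X n) ω) (r n) : ℝ) -
            ∫ ω', (CechBetti.cechBetti F k (CechBetti.samplePoints (X n) ω') (r n) : ℝ) ∂P))
        atTop (𝓝 0)) := by
  open CechBetti in
  set ν := volume.withDensity fun x => ENNReal.ofReal (f x) with hν
  have hprob : IsProbabilityMeasure ν := hf.isProbabilityMeasure
  obtain ⟨C, hC0, hC⟩ := hf.exists_measureReal_closedBall_le
  -- A bound on `n * r n ^ d` bounds the expected degrees uniformly in `n`, with `κ = C * R`.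
  obtain ⟨R, hR⟩ := hr.bddAbove_range
  have hR' : ∀ n : ℕ, (n : ℝ) * r n ^ d ≤ R := fun n => hR ⟨n, rfl⟩
  have hR0 : 0 ≤ R := (mul_nonneg (Nat.cast_nonneg 0) (pow_nonneg (hr_pos 0).le d)).trans (hR' 0)
  have hκ : 0 ≤ C * R := mul_nonneg hC0 hR0
  have hpn : ∀ n : ℕ, (n : ℝ) * (C * r n ^ d) ≤ C * R := fun n => by
    have := mul_le_mul_of_nonneg_left (hR' n) hC0
    linarith
  have hp : ∀ n z, ν.real (Metric.closedBall z (2 * r n)) ≤ C * r n ^ d := fun n z =>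
    hC (r n) (hr_pos n) z
  let G : ℕ → Configuration (EuclideanSpace ℝ (Fin d)) → ℝ := fun n S =>
    (cechBetti F k (S.points : Set (EuclideanSpace ℝ (Fin d))) (r n) : ℝ)
  have hG : ∀ n, IsLocalFunctional (G n) (2 * r n) := fun n =>
    isLocalFunctional_cechBetti F k (r n)
  constructor
  · intro Φ hΦ
    have hK : Bornology.IsBounded (tsupport f) := hf.isCompact_support.isBounded
    have hKm : MeasurableSet (tsupport f) := (isClosed_tsupport f).measurableSet
    have hνK : ν (tsupport f)ᶜ = 0 := hf.measure_compl_support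
    have hPois : ∀ n : ℕ, IsPoissonProcess (Φ n) ((n : NNReal) • ν) P := fun n => by
      rw [hν, ← hf.withDensity_mul n]
      exact hΦ n
    have hPoint : ∀ n, IsPointProcess (Φ n) := fun n =>
      ⟨(hΦ n).finite_inter, (hΦ n).measurable_count⟩
    let T : ∀ n : ℕ, Ω → Configuration (EuclideanSpace ℝ (Fin d)) := fun n =>
      (hPoint n).restrict hK
    have hT : ∀ n, Measurable (T n) := fun n =>
      (hPoint n).measurable_restrict hK hKm
    have hmap : ∀ n : ℕ, P.map (T n) = poissonSample ν n := fun n =>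
      (hPois n).map_restrict hK hKm hνK
    -- Almost surely no point lies outside the compact support, so the process may be replaced by
    -- its finite restriction.
    have hae : ∀ n : ℕ, (fun ω => G n (T n ω)) =ᵐ[P]
        fun ω => (cechBetti F k (Φ n ω) (r n) : ℝ) := fun n => by
      filter_upwards [(hPois n).ae_subset hKm (by simp [hνK])] with ω hω
      simp only [G, T]
      rw [IsPointProcess.coe_points_restrict, Set.inter_eq_left.2 hω]
    have hint : ∀ n : ℕ, Integrable (fun ω => (cechBetti F k (Φ n ω) (r n) : ℝ)) P := fun n => by
      refine Integrable.congr ?_ (hae n)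
      have := (hG n).integrable_poissonSample ν (n : NNReal)
      rw [← hmap n] at this
      exact this.comp_measurable (hT n)
    refine ⟨hint, ?_⟩
    refine ae_tendsto_zero_of_fourth_moment
      (fun n => ((hint n).sub (integrable_const _)).aestronglyMeasurable.aemeasurable)
      (16 * poissonConstant (C * R)) fun n hn => ?_
    rw [mul_assoc]
    -- Passing from the mean of the `n`-sample to the Poisson mean costs the factor 16.
    refine lintegral_sub_integral_pow_four_le (hint n)
      (c := ∫ x : Fin n → EuclideanSpace ℝ (Fin d), G n (sample x) ∂(Measure.pi fun _ => ν))
      (mul_nonneg (by unfold poissonConstant; positivity) (by positivity)) ?_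
    have h := (hG n).lintegral_poissonSample_le ν (hp n) hκ hn (hpn n)
    rw [← hmap n, lintegral_map (((hG n).measurable.sub_const _).pow_const 4).ennreal_ofReal
      (hT n)] at h
    refine (lintegral_congr_ae ?_).trans_le h
    filter_upwards [hae n] with ω hω
    rw [← hω]
  · intro X hX
    have hXm : ∀ n, Measurable fun ω i => X n i ω := fun n =>
      measurable_pi_iff.2 (hX n).measurable
    -- Independence turns the joint law of the sample into a product measure.
    have hmap : ∀ n, P.map (fun ω i => X n i ω) = Measure.pi fun _ => ν := fun n => by
      rw [(iIndepFun_iff_map_fun_eq_pi_map fun i => ((hX n).measurable i).aemeasurable).1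
        (hX n).iIndepFun]
      congr 1
      funext i
      exact ((hX n).hasLaw i).map_eq
    have heq : ∀ n ω, (cechBetti F k (samplePoints (X n) ω) (r n) : ℝ) =
        G n (sample fun i => X n i ω) := fun n ω => by
      simp only [G, coe_points_sample, samplePoints]
    have hb : ∀ n, BoundedMeasurable fun x : Fin n → EuclideanSpace ℝ (Fin d) =>
        G n (sample x) := fun n => (hG n).boundedMeasurable_sample n
    have hint : ∀ n, Integrable
        (fun ω => (cechBetti F k (samplePoints (X n) ω) (r n) : ℝ)) P := fun n => by
      simp only [heq]
      exact ((hb n).comp (hXm n)).integrable P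
    refine ⟨hint, ?_⟩
    refine ae_tendsto_zero_of_fourth_moment
      (fun n => ((hint n).sub (integrable_const _)).aestronglyMeasurable.aemeasurable)
      (320 * Real.exp (15 * (C * R))) fun n hn => ?_
    simp only [heq]
    have hmean : ∫ ω, G n (sample fun i => X n i ω) ∂P =
        ∫ x : Fin n → EuclideanSpace ℝ (Fin d), G n (sample x) ∂(Measure.pi fun _ => ν) := by
      rw [← hmap n, integral_map (hXm n).aemeasurable (hb n).measurable.aestronglyMeasurable]
    rw [hmean]
    set c := ∫ x : Fin n → EuclideanSpace ℝ (Fin d), G n (sample x) ∂(Measure.pi fun _ => ν)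
      with hc
    have hb4 := ((hb n).sub (BoundedMeasurable.const c)).pow 4
    rw [← lintegral_map (f := fun x => ENNReal.ofReal ((G n (sample x) - c) ^ 4))
      hb4.measurable.ennreal_ofReal (hXm n), hmap n,
      ← ofReal_integral_eq_lintegral_ofReal (hb4.integrable _)
        (Eventually.of_forall fun x => Even.pow_nonneg ⟨2, rfl⟩ _)]
    refine ENNReal.ofReal_le_ofReal (((hG n).fourth_moment_le ν (hp n) n).trans ?_)
    have hexp : Real.exp (15 * (C * r n ^ d) * n) ≤ Real.exp (15 * (C * R)) :=
      Real.exp_le_exp.2 (by linarith [hpn n])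
    gcongr
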